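/- Let $-\infty\le a<b\le\infty$, let $V\in L^1_{\mathrm{loc}}(a,b)$ be real-valued, let $I\subseteq\mathbb Z$, and let $(x_n)_{n\in I}$ be distinct points of $(a,b)$ such that $M=\{x_n\}_{n\in I}$ has no accumulation point in $(a,b)$. For $\alpha,\theta\in\mathbb R$ and $r>0$ put $$A_{\alpha,r,\theta}=\begin{pmatrix}1&\alpha\\0&1\end{pmatrix}\begin{pmatrix}r&0\\0&1/r\end{pmatrix}\begin{pmatrix}\cos\theta&-\sin\theta\\\sin\theta&\cos\theta\end{pmatrix}\in \mathrm{SL}(2,\mathbb R).$$ Let $\Lambda=(\alpha_n)_{n\in I}\subset\mathbb R$, $R=(r_n)_{n\in I}\subset(0,\infty)$, $\Theta=(\theta_n)_{n\in I}\subset\mathbb R$ and $\tau f=-f''+Vf$. For $z\in\mathbb C$, a solution of $(\tau_{\Lambda,R,\Theta}-z)f=0$ on an open interval $J\subseteq(a,b)$ is a function $f:J\to\mathbb C$ such that $f,f'$ are locally absolutely continuous in $J\setminus M$, $\tau f=zf$ almost everywhere in $J$, and $$\begin{pmatrix}f(x_n+)\\f'(x_n+)\end{pmatrix}=A_{\alpha_n,r_n,\theta_n}\begin{pmatrix}f(x_n-)\\f'(x_n-)\end{pmatrix}\qquad(\ast)$$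 for all $n\in I$ with $x_n\in J$. We say that $\tau_{\Lambda,R,\Theta}$ is in the limit circle case at $a$ (resp. $b$) if, for every $z\in\mathbb C$, every solution of $(\tau_{\Lambda,R,\Theta}-z)f=0$ on $(a,b)$ is square integrable near $a$ (resp. $b$). Write $[f,g]_x=\overline{f(x+)}\,g'(x+)-\overline{f'(x+)}\,g(x+)$, and $[f,g]_a$, $[f,g]_b$ for its limits as $x\to a+$, $x\to b-$. Fix $\lambda\in\mathbb R$ and non-trivial real solutions $v$ and $w$ of $(\tau_{\Lambda,R,\Theta}-\lambda)u=0$ near $a$ and near $b$, respectively. Let $H_{\Lambda,R,\Theta}$ be the operator $f\mapsto\tau f$ in $L^2(a,b)$ whose domain consists of all $f\in L^2(a,b)$ such that $f,f'$ are locally absolutely continuous in $(a,b)\setminus M$, $\tau f\in L^2(a,b)$, $(\ast)$ holds for all $n\in I$, $[v,f]_a=0$ if $\tau_{\Lambda,R,\Theta}$ is in the limit circle case at $a$, and $[w,f]_b=0$ if it is in the limit circle case at $b$. Fix $n_0\in I$ and $E\in\mathbb R$. Keep $v$, $w$ and all parameters with index $n\ne n_0$ fixed, and let $H_{\alpha,r,\theta}$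 be the operator obtained when the parameters at $n_0$ are $(\alpha,r,\theta)$. Let $$P(E)=\{(\alpha,r,\theta)\in\mathbb R\times(0,\infty)\times\mathbb R : E \text{ is an eigenvalue of } H_{\alpha,r,\theta}\}.$$ Then: a) For all $\alpha_0\in\mathbb R$, $r_0>0$, the set $\{(\alpha_0,r_0,\theta)\in P(E):\theta\in\mathbb R\}$ is empty or countably infinite. b) For all $\alpha_0,\theta_0\in\mathbb R$, the set $\{(\alpha_0,r,\theta_0)\in P(E):r>0\}$ has at most one element or equals $\{\alpha_0\}\times(0,\infty)\times\{\theta_0\}$. c) For all $r_0>0$, $\theta_0\in\mathbb R$, the set $\{(\alpha,r_0,\theta_0)\in P(E):\alpha\in\mathbb R\}$ has at most one element or equals $\mathbb R\times\{r_0\}\times\{\theta_0\}$. -/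

import Mathlib

open Filter Topology MeasureTheory Set

noncomputable section

namespace PointInteraction

/-- The open interval `(a, b)` of real numbers, with possibly infinite endpoints. -/
def interval (a b : EReal) : Set ℝ := {t : ℝ | a < (t : EReal) ∧ (t : EReal) < b}

/-! ### The interaction matrices -/

/-- Parabolic factor. -/
def parabolic (α : ℝ) : Matrix (Fin 2) (Fin 2) ℝ := !![1, α; 0, 1]

/-- Hyperbolic factor (used for `0 < r`). -/
def hyperbolic (r : ℝ) : Matrix (Fin 2) (Fin 2) ℝ := !![r, 0; 0, 1 / r]

/-- Elliptic factor. -/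
def elliptic (θ : ℝ) : Matrix (Fin 2) (Fin 2) ℝ :=
  !![Real.cos θ, -Real.sin θ; Real.sin θ, Real.cos θ]

/-- The `SL(2, ℝ)` matrix with Iwasawa decomposition `P_α H_r E_θ`. -/
def interactionMatrix (α r θ : ℝ) : Matrix (Fin 2) (Fin 2) ℝ :=
  parabolic α * hyperbolic r * elliptic θ

/-- The three families `(α_n)`, `(r_n)`, `(θ_n)` of interaction parameters. -/
structure Couplings (I : Set ℤ) where
  alpha : I → ℝ
  r : I → ℝ
  theta : I → ℝ

namespace Couplings

/-- The interaction matrix at the `n`-th point. -/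
def matrix {I : Set ℤ} (κ : Couplings I) (n : I) : Matrix (Fin 2) (Fin 2) ℝ :=
  interactionMatrix (κ.alpha n) (κ.r n) (κ.theta n)

/-- Replace the parameters of the interaction `n₀`, keeping all the others. -/
def replaceAt {I : Set ℤ} (κ : Couplings I) (n₀ : I) (α r θ : ℝ) : Couplings I where
  alpha := Function.update κ.alpha n₀ α
  r := Function.update κ.r n₀ r
  theta := Function.update κ.theta n₀ θ

end Couplings

/-! ### Functions with point interactions -/

/-- `f` is (locally) absolutely continuous in `s`: absolutely continuous on every compact
interval contained in `s`. -/
def LocallyAC (f : ℝ → ℂ) (s : Set ℝ) : Prop :=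
  ∀ c d : ℝ, c ≤ d → Icc c d ⊆ s → AbsolutelyContinuousOnInterval f c d

/-- The one-sided limits of `f` and `f'` at `p` exist and satisfy
`(f(p+), f'(p+)) = A (f(p-), f'(p-))`. -/
def JumpCondition (A : Matrix (Fin 2) (Fin 2) ℝ) (p : ℝ) (f : ℝ → ℂ) : Prop :=
  ∃ l : Fin 2 → ℂ,
    Tendsto (fun t => ![f t, deriv f t]) (𝓝[<] p) (𝓝 l) ∧
    Tendsto (fun t => ![f t, deriv f t]) (𝓝[>] p)
      (𝓝 ((A.map (fun y : ℝ => (y : ℂ))).mulVec l))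

/-- On `(a, b)`, `f` and `f'` are absolutely continuous away from the interaction points, and `f`
satisfies the jump conditions at all interaction points in `(a, b)`. -/
def Connected {I : Set ℤ} (a b : EReal) (x : I → ℝ) (κ : Couplings I) (f : ℝ → ℂ) : Prop :=
  LocallyAC f (interval a b \ range x) ∧
  LocallyAC (deriv f) (interval a b \ range x) ∧
  ∀ n : I, x n ∈ interval a b → JumpCondition (κ.matrix n) (x n) f

/-- The differential expression `τ f = -f'' + V f`. -/
def tau (V : ℝ → ℝ) (f : ℝ → ℂ) : ℝ → ℂ :=
  fun t => -deriv (deriv f) t + (V t : ℂ) * f t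

/-- `f` is a solution of `(τ_{Λ,R,Θ} - z) f = 0` on `(a, b)`. -/
def IsSolution {I : Set ℤ} (a b : EReal) (V : ℝ → ℝ) (x : I → ℝ) (κ : Couplings I) (z : ℂ)
    (f : ℝ → ℂ) : Prop :=
  Connected a b x κ f ∧
  ∀ᵐ t ∂(volume.restrict (interval a b)), tau V f t - z * f t = 0

/-- `v` is a non-trivial real solution of `(τ_{Λ,R,Θ} - lam) v = 0` near `a`. -/
def IsRealSolutionNearLeft {I : Set ℤ} (a b : EReal) (V : ℝ → ℝ) (x : I → ℝ) (κ : Couplings I)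
    (lam : ℝ) (v : ℝ → ℝ) : Prop :=
  ∃ c : ℝ, c ∈ interval a b ∧
    IsSolution a c V x κ (lam : ℂ) (fun t => (v t : ℂ)) ∧
    ∃ t ∈ interval a c \ range x, v t ≠ 0

/-- `w` is a non-trivial real solution of `(τ_{Λ,R,Θ} - lam) w = 0` near `b`. -/
def IsRealSolutionNearRight {I : Set ℤ} (a b : EReal) (V : ℝ → ℝ) (x : I → ℝ) (κ : Couplings I)
    (lam : ℝ) (w : ℝ → ℝ) : Prop :=
  ∃ c : ℝ, c ∈ interval a b ∧
    IsSolution c b V x κ (lam : ℂ) (fun t => (w t : ℂ)) ∧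
    ∃ t ∈ interval c b \ range x, w t ≠ 0

/-! ### Limit circle case -/

/-- `f` lies left in `L²(a, b)`: it is square integrable in a neighbourhood of `a`. -/
def LiesLeft (a b : EReal) (f : ℝ → ℂ) : Prop :=
  ∃ c : ℝ, c ∈ interval a b ∧ MemLp f 2 (volume.restrict (interval a c))

/-- `f` lies right in `L²(a, b)`: it is square integrable in a neighbourhood of `b`. -/
def LiesRight (a b : EReal) (f : ℝ → ℂ) : Prop :=
  ∃ c : ℝ, c ∈ interval a b ∧ MemLp f 2 (volume.restrict (interval c b))

/-- Limit circle case at `a`. -/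
def LimitCircleLeft {I : Set ℤ} (a b : EReal) (V : ℝ → ℝ) (x : I → ℝ) (κ : Couplings I) : Prop :=
  ∀ (z : ℂ) (f : ℝ → ℂ), IsSolution a b V x κ z f → LiesLeft a b f

/-- Limit circle case at `b`. -/
def LimitCircleRight {I : Set ℤ} (a b : EReal) (V : ℝ → ℝ) (x : I → ℝ) (κ : Couplings I) : Prop :=
  ∀ (z : ℂ) (f : ℝ → ℂ), IsSolution a b V x κ z f → LiesRight a b f

/-! ### The operators -/

/-- The Lagrange bracket `[f, g]_t = conj (f(t+)) g'(t+) - conj (f'(t+)) g(t+)`. -/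
def lagrangeBracket (f g : ℝ → ℂ) (t : ℝ) : ℂ :=
  starRingEnd ℂ (Function.rightLim f t) * Function.rightLim (deriv g) t -
    starRingEnd ℂ (Function.rightLim (deriv f) t) * Function.rightLim g t

/-- The domain of the maximal operator `T_{Λ,R,Θ}`. -/
def maximalDomain {I : Set ℤ} (a b : EReal) (V : ℝ → ℝ) (x : I → ℝ) (κ : Couplings I) :
    Set (ℝ → ℂ) :=
  {f | MemLp f 2 (volume.restrict (interval a b)) ∧
    Connected a b x κ f ∧
    MemLp (tau V f) 2 (volume.restrict (interval a b))}

/-- The domain of the selfadjoint restriction `H_{Λ,R,Θ}` of the maximal operator: the boundary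
condition `[v, f]_a = 0` is imposed in the limit circle case at `a`, and `[w, f]_b = 0` in the
limit circle case at `b`. On this domain `H_{Λ,R,Θ} f = τ f`. -/
def operatorDomain {I : Set ℤ} (a b : EReal) (V : ℝ → ℝ) (x : I → ℝ) (v w : ℝ → ℝ)
    (κ : Couplings I) : Set (ℝ → ℂ) :=
  {f | f ∈ maximalDomain a b V x κ ∧
    (LimitCircleLeft a b V x κ →
      Tendsto (lagrangeBracket (fun t => (v t : ℂ)) f)
        (comap (fun t : ℝ => (t : EReal)) (𝓝[>] a)) (𝓝 0)) ∧
    (LimitCircleRight a b V x κ →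
      Tendsto (lagrangeBracket (fun t => (w t : ℂ)) f)
        (comap (fun t : ℝ => (t : EReal)) (𝓝[<] b)) (𝓝 0))}

/-- The set `σ_p(H_{Λ,R,Θ})` of eigenvalues: there is an element `f` of the domain, non-zero in
`L²(a, b)`, with `H f = z f` in `L²(a, b)`. -/
def pointSpectrum {I : Set ℤ} (a b : EReal) (V : ℝ → ℝ) (x : I → ℝ) (v w : ℝ → ℝ)
    (κ : Couplings I) : Set ℂ :=
  {z | ∃ f ∈ operatorDomain a b V x v w κ,
    ¬ (∀ᵐ t ∂(volume.restrict (interval a b)), f t = 0) ∧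
    ∀ᵐ t ∂(volume.restrict (interval a b)), tau V f t = z * f t}

/-- The set `P(E)` of all `(α, r, θ) ∈ ℝ × (0, ∞) × ℝ` such that `E` is an eigenvalue of the
operator in which the interaction `n₀` has the parameters `α, r, θ`. -/
def parameterSet {I : Set ℤ} (a b : EReal) (V : ℝ → ℝ) (x : I → ℝ) (v w : ℝ → ℝ)
    (κ : Couplings I) (n₀ : I) (E : ℝ) : Set (ℝ × ℝ × ℝ) :=
  {p | 0 < p.2.1 ∧
    (E : ℂ) ∈ pointSpectrum a b V x v w (κ.replaceAt n₀ p.1 p.2.1 p.2.2)}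

end PointInteraction

end

/-! Cut the line at `p = x n₀`. An eigenfunction restricts to a square integrable solution on each
side of `p`, subject to the boundary condition at that end in the limit circle case. Conversely, two
such solutions glue to an eigenfunction exactly when the interaction matrix `A` maps the boundary
value at `p-` to the one at `p+` (`mem_pointSpectrum_iff`). The two sets of admissible boundary
values do not depend on the parameters at `n₀`, since the limit circle property depends only on the
couplings near the end (`liesAt_of_couplings_eq`).

Each set has dimension at most one (`boundaryValues_det_eq_zero`). If two independent solutions for
`E` were admissible, variation of constants near the end (`coeffNorm_le_two_mul`) would control the
solutions for every other spectral parameter. In the limit point case all of them would be square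
integrable, a contradiction. In the limit circle case both Wronskians with `v` would tend to zero,
forcing `v = 0`.

If `l` and `m` span the left and right boundary values, then `E` is an eigenvalue iff `det (A l, m)
= 0`. Multiplied by `r`, this reads `r² (cos θ l₁ - sin θ l₂) m₂ + (sin θ l₁ + cos θ l₂) (α m₂ - m₁)
= 0` (`exists_matrix_condition`). It is affine in `α` and in `r²`, which gives c) and b). In `θ` it
has the form `X cos θ + Y sin θ = 0`. The left line is invariant under conjugation, so `l₁² + l₂² ≠
0`; hence `(X, Y) ≠ 0`, and the zeros are empty or a translate of `πℤ`, which gives a).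

As `V` is only locally integrable, everything is phrased with a primitive `Q` of `V` and the
quasi-derivative `f' - Q f`. The equation then becomes a first order system with continuous
coefficients, to which Picard–Lindelöf applies, and it holds pointwise off the interaction points.
-/

noncomputable section

namespace PointInteraction

variable {I : Set ℤ}

/-! ### Pointwise reformulation of the solution concept -/

/-- The jump condition in terms of the four one-sided limits. -/
theorem jumpCondition_iff {A : Matrix (Fin 2) (Fin 2) ℝ} {p : ℝ} {f : ℝ → ℂ} :
    JumpCondition A p f ↔ ∃ l₀ l₁ : ℂ, Tendsto f (𝓝[<] p) (𝓝 l₀) ∧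
      Tendsto (deriv f) (𝓝[<] p) (𝓝 l₁) ∧
      Tendsto f (𝓝[>] p) (𝓝 (A 0 0 * l₀ + A 0 1 * l₁)) ∧
      Tendsto (deriv f) (𝓝[>] p) (𝓝 (A 1 0 * l₀ + A 1 1 * l₁)) := by
  constructor
  · rintro ⟨l, h₁, h₂⟩
    rw [tendsto_pi_nhds] at h₁ h₂
    refine ⟨l 0, l 1, h₁ 0, h₁ 1, ?_, ?_⟩
    · simpa [Matrix.mulVec, dotProduct, Fin.sum_univ_two] using h₂ 0
    · simpa [Matrix.mulVec, dotProduct, Fin.sum_univ_two] using h₂ 1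
  · rintro ⟨l₀, l₁, h₁, h₂, h₃, h₄⟩
    refine ⟨![l₀, l₁], ?_, ?_⟩
    · rw [tendsto_pi_nhds]
      intro i
      fin_cases i
      · simpa using h₁
      · simpa using h₂
    · rw [tendsto_pi_nhds]
      intro i
      fin_cases i
      · simpa [Matrix.mulVec, dotProduct, Fin.sum_univ_two] using h₃
      · simpa [Matrix.mulVec, dotProduct, Fin.sum_univ_two] using h₄

/-- `f` satisfies the equation `(τ - z) f = 0` at `q`, written for a primitive `Q` of the potential
with the quasi-derivative `f' - Q f`, and the jump condition if `q` is an interaction point. -/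
def SolAt (Q : ℝ → ℝ) (x : I → ℝ) (κ : Couplings I) (z : ℂ) (f : ℝ → ℂ) (q : ℝ) : Prop :=
  (q ∉ range x → DifferentiableAt ℝ f q ∧
    HasDerivAt (fun t => deriv f t - Q t * f t) (-z * f q - Q q * deriv f q) q) ∧
  ∀ n : I, x n = q → JumpCondition (κ.matrix n) q f

/-- `f` is a solution of `(τ - z) f = 0` at all points of `J`. -/
def SolOn (J : Set ℝ) (Q : ℝ → ℝ) (x : I → ℝ) (κ : Couplings I) (z : ℂ) (f : ℝ → ℂ) : Prop :=
  ∀ q ∈ J, SolAt Q x κ z f q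

/-- The standing assumptions on an open interval `J`, a primitive `Q` of the potential and the
point interactions. -/
structure Regular (J : Set ℝ) (Q : ℝ → ℝ) (x : I → ℝ) (κ : Couplings I) : Prop where
  isOpen : IsOpen J
  ordConnected : J.OrdConnected
  discrete : ∀ q ∈ J, ∀ᶠ t in 𝓝[≠] q, t ∉ range x
  continuousOn : ContinuousOn Q J
  det : ∀ n, (κ.matrix n).det = 1
  injective : Function.Injective x

variable {J J' : Set ℝ} {Q : ℝ → ℝ} {x : I → ℝ} {κ κ' : Couplings I} {z z₁ z₂ : ℂ}
  {f g h : ℝ → ℂ} {q s t : ℝ}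

theorem Regular.mono (hR : Regular J Q x κ) (hJ' : IsOpen J') (ho : J'.OrdConnected)
    (hs : J' ⊆ J) : Regular J' Q x κ where
  isOpen := hJ'
  ordConnected := ho
  discrete q hq := hR.discrete q (hs hq)
  continuousOn := hR.continuousOn.mono hs
  det := hR.det
  injective := hR.injective

theorem Regular.eventually_diff (hR : Regular J Q x κ) (hq : q ∈ J) :
    ∀ᶠ t in 𝓝[≠] q, t ∈ J \ range x := by
  filter_upwards [hR.discrete q hq, nhdsWithin_le_nhds (hR.isOpen.mem_nhds hq)] with t h₁ h₂
  exact ⟨h₂, h₁⟩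

theorem Regular.isOpen_diff (hR : Regular J Q x κ) : IsOpen (J \ range x) := by
  rw [isOpen_iff_mem_nhds]
  rintro q ⟨hq, hqx⟩
  have := hR.eventually_diff hq
  rw [eventually_nhdsWithin_iff] at this
  filter_upwards [this] with t ht
  by_cases htq : t = q
  · exact htq ▸ ⟨hq, hqx⟩
  · exact ht htq

theorem Regular.subset_closure (hR : Regular J Q x κ) : J ⊆ closure (J \ range x) := by
  intro q hq
  rw [mem_closure_iff_frequently]
  exact (hR.eventually_diff hq).frequently.filter_mono nhdsWithin_le_nhds

theorem Regular.continuousAt (hR : Regular J Q x κ) (hq : q ∈ J) : ContinuousAt Q q :=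
  hR.continuousOn.continuousAt (hR.isOpen.mem_nhds hq)

theorem JumpCondition.congr {A : Matrix (Fin 2) (Fin 2) ℝ} {p : ℝ}
    (hfg : f =ᶠ[𝓝 p] g) (hf : JumpCondition A p f) : JumpCondition A p g := by
  obtain ⟨l₀, l₁, h₁, h₂, h₃, h₄⟩ := jumpCondition_iff.1 hf
  have hd := hfg.deriv
  exact jumpCondition_iff.2 ⟨l₀, l₁, h₁.congr' (hfg.filter_mono nhdsWithin_le_nhds),
    h₂.congr' (hd.filter_mono nhdsWithin_le_nhds),
    h₃.congr' (hfg.filter_mono nhdsWithin_le_nhds),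
    h₄.congr' (hd.filter_mono nhdsWithin_le_nhds)⟩

theorem SolAt.congr (hfg : f =ᶠ[𝓝 q] g) (hf : SolAt Q x κ z f q) : SolAt Q x κ z g q := by
  refine ⟨fun hq => ⟨(hf.1 hq).1.congr_of_eventuallyEq hfg.symm, ?_⟩,
    fun n hn => (hf.2 n hn).congr hfg⟩
  rw [← hfg.eq_of_nhds, ← hfg.deriv.eq_of_nhds]
  refine (hf.1 hq).2.congr_of_eventuallyEq ?_
  filter_upwards [hfg, hfg.deriv] with t h₁ h₂
  rw [h₁, h₂]

theorem SolOn.mono (hf : SolOn J Q x κ z f) (hs : J' ⊆ J) : SolOn J' Q x κ z f :=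
  fun q hq => hf q (hs hq)

theorem SolOn.congr (hJ : IsOpen J) (hf : SolOn J Q x κ z f) (hfg : EqOn f g J) :
    SolOn J Q x κ z g :=
  fun q hq => (hf q hq).congr (hfg.eventuallyEq_of_mem (hJ.mem_nhds hq))

/-- Solutions only depend on the couplings of the interaction points in the interval. -/
theorem SolOn.congr_couplings (hf : SolOn J Q x κ z f)
    (hκ : ∀ n, x n ∈ J → κ.matrix n = κ'.matrix n) : SolOn J Q x κ' z f := fun q hq =>
  ⟨(hf q hq).1, fun n hn => hκ n (hn ▸ hq) ▸ (hf q hq).2 n hn⟩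

theorem SolOn.hasDerivAt (hf : SolOn J Q x κ z f) (hq : q ∈ J \ range x) :
    HasDerivAt f (deriv f q) q :=
  ((hf q hq.1).1 hq.2).1.hasDerivAt

theorem SolOn.continuousAt (hf : SolOn J Q x κ z f) (hq : q ∈ J \ range x) : ContinuousAt f q :=
  (hf.hasDerivAt hq).continuousAt

/-- The quasi-derivative is differentiable and `Q f` is continuous; `f'` is their sum. -/
theorem SolOn.continuousAt_deriv (hR : Regular J Q x κ) (hf : SolOn J Q x κ z f)
    (hq : q ∈ J \ range x) : ContinuousAt (deriv f) q := by
  have h₁ := ((hf q hq.1).1 hq.2).2.continuousAt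
  have h₂ : ContinuousAt (fun t => (Q t : ℂ) * f t) q :=
    (Complex.continuous_ofReal.continuousAt.comp (hR.continuousAt hq.1)).mul
      (hf.continuousAt hq)
  exact (h₁.add h₂).congr (Eventually.of_forall fun t => by simp)

theorem SolOn.continuousOn (hf : SolOn J Q x κ z f) : ContinuousOn f (J \ range x) :=
  fun _ hq => (hf.continuousAt hq).continuousWithinAt

theorem SolOn.continuousOn_deriv (hR : Regular J Q x κ) (hf : SolOn J Q x κ z f) :
    ContinuousOn (deriv f) (J \ range x) :=
  fun _ hq => (hf.continuousAt_deriv hR hq).continuousWithinAt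

theorem SolOn.exists_tendsto_left (hR : Regular J Q x κ) (hf : SolOn J Q x κ z f) (hq : q ∈ J) :
    ∃ l₀ l₁ : ℂ, Tendsto f (𝓝[<] q) (𝓝 l₀) ∧ Tendsto (deriv f) (𝓝[<] q) (𝓝 l₁) := by
  by_cases hqx : q ∈ range x
  · obtain ⟨n, hn⟩ := hqx
    obtain ⟨l₀, l₁, h₁, h₂, -, -⟩ := jumpCondition_iff.1 ((hf q hq).2 n hn)
    exact ⟨l₀, l₁, h₁, h₂⟩
  · exact ⟨_, _, (hf.continuousAt ⟨hq, hqx⟩).mono_left nhdsWithin_le_nhds,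
      (hf.continuousAt_deriv hR ⟨hq, hqx⟩).mono_left nhdsWithin_le_nhds⟩

theorem SolOn.exists_tendsto_right (hR : Regular J Q x κ) (hf : SolOn J Q x κ z f) (hq : q ∈ J) :
    ∃ l₀ l₁ : ℂ, Tendsto f (𝓝[>] q) (𝓝 l₀) ∧ Tendsto (deriv f) (𝓝[>] q) (𝓝 l₁) := by
  by_cases hqx : q ∈ range x
  · obtain ⟨n, hn⟩ := hqx
    obtain ⟨l₀, l₁, -, -, h₁, h₂⟩ := jumpCondition_iff.1 ((hf q hq).2 n hn)
    exact ⟨_, _, h₁, h₂⟩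
  · exact ⟨_, _, (hf.continuousAt ⟨hq, hqx⟩).mono_left nhdsWithin_le_nhds,
      (hf.continuousAt_deriv hR ⟨hq, hqx⟩).mono_left nhdsWithin_le_nhds⟩

/-! ### Measurability and local integrability of solutions. -/

theorem ae_notMem_range (x : I → ℝ) (μ : Measure ℝ) (hμ : μ ≪ volume) :
    ∀ᵐ t ∂μ, t ∉ range x :=
  hμ.ae_le ((countable_range x).ae_notMem volume)

theorem diff_range_ae_eq (x : I → ℝ) (J : Set ℝ) : (J \ range x : Set ℝ) =ᵐ[volume] J :=
  sdiff_null_ae_eq_self ((countable_range x).measure_zero volume)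

theorem SolOn.aestronglyMeasurable (hR : Regular J Q x κ) (hf : SolOn J Q x κ z f) :
    AEStronglyMeasurable f (volume.restrict J) := by
  rw [← Measure.restrict_congr_set (diff_range_ae_eq x J)]
  exact hf.continuousOn.aestronglyMeasurable hR.isOpen_diff.measurableSet

/-- Products of solutions are locally integrable. -/
theorem SolOn.locallyIntegrableOn_mul (hR : Regular J Q x κ) (hf : SolOn J Q x κ z₁ f)
    (hh : SolOn J Q x κ z₂ h) : LocallyIntegrableOn (fun t => f t * h t) J := by
  intro q hq
  rw [hR.isOpen.nhdsWithin_eq hq]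
  have hm : ∀ l ≤ 𝓝 q, StronglyMeasurableAtFilter (fun t => f t * h t) l volume := fun l hl =>
    ⟨J, hl (hR.isOpen.mem_nhds hq), (hf.aestronglyMeasurable hR).mul (hh.aestronglyMeasurable hR)⟩
  have hfin : ∀ l ≤ 𝓝 q, (volume : Measure ℝ).FiniteAtFilter l := fun l hl =>
    (volume.finiteAt_nhds q).filter_mono hl
  obtain ⟨l₀, -, h₁, -⟩ := hf.exists_tendsto_left hR hq
  obtain ⟨m₀, -, h₂, -⟩ := hh.exists_tendsto_left hR hq
  obtain ⟨l₀', -, h₃, -⟩ := hf.exists_tendsto_right hR hq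
  obtain ⟨m₀', -, h₄, -⟩ := hh.exists_tendsto_right hR hq
  have hl := (h₁.mul h₂).integrableAtFilter (hm _ nhdsWithin_le_nhds) (hfin _ nhdsWithin_le_nhds)
  have hr := (h₃.mul h₄).integrableAtFilter (hm _ nhdsWithin_le_nhds) (hfin _ nhdsWithin_le_nhds)
  -- The one-sided neighbourhoods together give only a punctured one; the missing point `q` is a
  -- null set.
  obtain ⟨S, hS, hSi⟩ := IntegrableAtFilter.sup_iff.2 ⟨hl, hr⟩
  rw [nhdsLT_sup_nhdsGT] at hS
  refine ⟨insert q S, ?_, ?_⟩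
  · rwa [insert_mem_nhds_iff]
  · exact hSi.congr_set_ae (insert_ae_eq_self q S)

/-! ### The Wronskian -/

/-- The bilinear Wronskian `f h' - f' h`. -/
def wronskian (f h : ℝ → ℂ) (t : ℝ) : ℂ := f t * deriv h t - deriv f t * h t

/-- The terms `Q f h` cancel, so the Wronskian may be formed with quasi-derivatives, which can be
differentiated pointwise. -/
theorem SolOn.hasDerivAt_wronskian (hf : SolOn J Q x κ z₁ f)
    (hh : SolOn J Q x κ z₂ h) (hq : q ∈ J \ range x) :
    HasDerivAt (wronskian f h) ((z₁ - z₂) * (f q * h q)) q := by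
  have h₁ := ((hf q hq.1).1 hq.2).2
  have h₂ := ((hh q hq.1).1 hq.2).2
  have h₃ := ((hf.hasDerivAt hq).mul h₂).sub (h₁.mul (hh.hasDerivAt hq))
  refine (h₃.congr_deriv ?_).congr_of_eventuallyEq (Eventually.of_forall fun t => ?_)
  · ring
  · simp only [wronskian, Pi.sub_apply, Pi.mul_apply]; ring

/-- The Wronskian is the determinant of the two data vectors, so a jump matrix of determinant one
leaves its one-sided limits equal. -/
theorem SolOn.exists_tendsto_wronskian (hR : Regular J Q x κ) (hf : SolOn J Q x κ z₁ f)
    (hh : SolOn J Q x κ z₂ h) (hq : q ∈ J) :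
    ∃ L, Tendsto (wronskian f h) (𝓝[≠] q) (𝓝 L) := by
  by_cases hqx : q ∈ range x
  · obtain ⟨n, hn⟩ := hqx
    obtain ⟨l₀, l₁, h₁, h₂, h₃, h₄⟩ := jumpCondition_iff.1 ((hf q hq).2 n hn)
    obtain ⟨m₀, m₁, k₁, k₂, k₃, k₄⟩ := jumpCondition_iff.1 ((hh q hq).2 n hn)
    refine ⟨l₀ * m₁ - l₁ * m₀, ?_⟩
    rw [← nhdsLT_sup_nhdsGT, tendsto_sup]
    refine ⟨(h₁.mul k₂).sub (h₂.mul k₁), ?_⟩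
    have hdet := hR.det n
    rw [Matrix.det_fin_two] at hdet
    have hdet' : (κ.matrix n 0 0 : ℂ) * κ.matrix n 1 1 - κ.matrix n 0 1 * κ.matrix n 1 0 = 1 := by
      exact_mod_cast hdet
    refine ((h₃.mul k₄).sub (h₄.mul k₃)).trans_eq (congrArg 𝓝 ?_)
    linear_combination (l₀ * m₁ - l₁ * m₀) * hdet'
  · exact ⟨_, (hf.hasDerivAt_wronskian hh ⟨hq, hqx⟩).continuousAt.mono_left nhdsWithin_le_nhds⟩

theorem SolOn.intervalIntegrable_mul (hR : Regular J Q x κ) (hf : SolOn J Q x κ z₁ f)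
    (hh : SolOn J Q x κ z₂ h) (hs : s ∈ J) (ht : t ∈ J) :
    IntervalIntegrable (fun r => f r * h r) volume s t :=
  ((hf.locallyIntegrableOn_mul hR hh).integrableOn_compact_subset
    (hR.ordConnected.uIcc_subset hs ht) isCompact_uIcc).intervalIntegrable

/-- Green's formula: point interactions with unimodular matrices do not contribute. -/
theorem SolOn.wronskian_sub (hR : Regular J Q x κ) (hf : SolOn J Q x κ z₁ f)
    (hh : SolOn J Q x κ z₂ h) (hs : s ∈ J \ range x) (ht : t ∈ J \ range x) :
    wronskian f h t - wronskian f h s = (z₁ - z₂) * ∫ r in s..t, f r * h r := by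
  -- At an interaction point the values of `f` and `deriv f` carry no meaning. The continuous
  -- extension of the Wronskian replaces them, and the fundamental theorem of calculus tolerates the
  -- countable exceptional set.
  set F := extendFrom (J \ range x) (wronskian f h)
  have hlim : ∀ q ∈ J, ∃ y, Tendsto (wronskian f h) (𝓝[J \ range x] q) (𝓝 y) := by
    intro q hq
    by_cases hqx : q ∈ range x
    · obtain ⟨L, hL⟩ := hf.exists_tendsto_wronskian hR hh hq
      refine ⟨L, hL.mono_left (nhdsWithin_mono _ ?_)⟩
      rintro t ht rfl
      exact ht.2 hqx
    · exact ⟨_, (hf.hasDerivAt_wronskian hh ⟨hq, hqx⟩).continuousAt.mono_left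
        nhdsWithin_le_nhds⟩
  have hF : ContinuousOn F J := continuousOn_extendFrom hR.subset_closure hlim
  have hFeq : ∀ q ∈ J \ range x, F q = wronskian f h q := extendFrom_extends
    fun q hq => (hf.hasDerivAt_wronskian hh hq).continuousAt.continuousWithinAt
  have hsub := hR.ordConnected.uIcc_subset hs.1 ht.1
  rw [← hFeq t ht, ← hFeq s hs, ← intervalIntegral.integral_const_mul]
  refine (integral_eq_of_hasDerivAt_off_countable F _ (countable_range x) (hF.mono hsub)
    (fun q hq => ?_) ((hf.intervalIntegrable_mul hR hh hs.1 ht.1).const_mul _)).symm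
  have hqJ : q ∈ J \ range x := ⟨hsub (Ioo_subset_Icc_self hq.1), hq.2⟩
  refine (hf.hasDerivAt_wronskian hh hqJ).congr_of_eventuallyEq ?_
  filter_upwards [hR.isOpen_diff.mem_nhds hqJ] with r hr using hFeq r hr

theorem SolOn.wronskian_eq (hR : Regular J Q x κ) (hf : SolOn J Q x κ z f)
    (hh : SolOn J Q x κ z h) (hs : s ∈ J \ range x) (ht : t ∈ J \ range x) :
    wronskian f h t = wronskian f h s := by
  have := hf.wronskian_sub hR hh hs ht
  rw [sub_self, zero_mul] at this
  exact sub_eq_zero.1 this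

/-- Expansion with respect to two functions with non-vanishing Wronskian. -/
theorem wronskian_mul_eq (f u₁ u₂ : ℝ → ℂ) (t : ℝ) :
    wronskian u₁ u₂ t * f t = wronskian f u₂ t * u₁ t - wronskian f u₁ t * u₂ t := by
  simp only [wronskian]; ring

theorem wronskian_mul_deriv_eq (f u₁ u₂ : ℝ → ℂ) (t : ℝ) :
    wronskian u₁ u₂ t * deriv f t =
      wronskian f u₂ t * deriv u₁ t - wronskian f u₁ t * deriv u₂ t := by
  simp only [wronskian]; ring

theorem SolOn.deriv_linearCombination (hf : SolOn J Q x κ z f)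
    (hg : SolOn J Q x κ z g) (c d : ℂ) (hq : q ∈ J \ range x) :
    deriv (fun t => c * f t + d * g t) q = c * deriv f q + d * deriv g q :=
  (((hf.hasDerivAt hq).const_mul c).add ((hg.hasDerivAt hq).const_mul d)).deriv

theorem SolOn.linearCombination (hR : Regular J Q x κ) (hf : SolOn J Q x κ z f)
    (hg : SolOn J Q x κ z g) (c d : ℂ) : SolOn J Q x κ z (fun t => c * f t + d * g t) := by
  intro q hq
  have hd : ∀ᶠ t in 𝓝[≠] q, deriv (fun t => c * f t + d * g t) t =
      c * deriv f t + d * deriv g t := by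
    filter_upwards [hR.eventually_diff hq] with t ht
    exact hf.deriv_linearCombination hg c d ht
  refine ⟨fun hqx => ?_, fun n hn => ?_⟩
  · have h₁ := (hf q hq).1 hqx
    have h₂ := (hg q hq).1 hqx
    refine ⟨(h₁.1.const_mul c).add (h₂.1.const_mul d), ?_⟩
    rw [hf.deriv_linearCombination hg c d ⟨hq, hqx⟩]
    refine (((h₁.2.const_mul c).add (h₂.2.const_mul d)).congr_deriv ?_).congr_of_eventuallyEq ?_
    · ring
    · filter_upwards [hR.isOpen_diff.mem_nhds ⟨hq, hqx⟩] with t ht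
      rw [hf.deriv_linearCombination hg c d ht]
      simp only [Pi.add_apply]
      ring
  · obtain ⟨l₀, l₁, h₁, h₂, h₃, h₄⟩ := jumpCondition_iff.1 ((hf q hq).2 n hn)
    obtain ⟨m₀, m₁, k₁, k₂, k₃, k₄⟩ := jumpCondition_iff.1 ((hg q hq).2 n hn)
    have hdl := hd.filter_mono (nhdsWithin_mono q fun t (ht : t < q) => ht.ne)
    have hdr := hd.filter_mono (nhdsWithin_mono q fun t (ht : q < t) => ht.ne')
    refine jumpCondition_iff.2 ⟨c * l₀ + d * m₀, c * l₁ + d * m₁,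
      (h₁.const_mul c).add (k₁.const_mul d),
      ((h₂.const_mul c).add (k₂.const_mul d)).congr' (hdl.mono fun _ h => h.symm), ?_, ?_⟩
    · exact ((h₃.const_mul c).add (k₃.const_mul d)).trans_eq (congrArg 𝓝 (by ring))
    · exact (((h₄.const_mul c).add (k₄.const_mul d)).congr' (hdr.mono fun _ h => h.symm)).trans_eq
        (congrArg 𝓝 (by ring))

/-- Two solutions with the same data at one point agree wherever a fundamental system exists. -/
theorem SolOn.eqOn_of_fundamental (hR : Regular J Q x κ) {u₁ u₂ : ℝ → ℂ}
    (hu₁ : SolOn J Q x κ z u₁) (hu₂ : SolOn J Q x κ z u₂) (hf : SolOn J Q x κ z f)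
    (hg : SolOn J Q x κ z g) (hs : s ∈ J \ range x) (hw : wronskian u₁ u₂ s ≠ 0)
    (h₀ : f s = g s) (h₁ : deriv f s = deriv g s) : EqOn f g (J \ range x) := by
  intro t ht
  have hw' : wronskian u₁ u₂ t ≠ 0 := by rwa [hu₁.wronskian_eq hR hu₂ hs ht]
  apply mul_left_cancel₀ hw'
  rw [wronskian_mul_eq f, wronskian_mul_eq g, hf.wronskian_eq hR hu₂ hs ht,
    hf.wronskian_eq hR hu₁ hs ht, hg.wronskian_eq hR hu₂ hs ht, hg.wronskian_eq hR hu₁ hs ht]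
  simp only [wronskian, h₀, h₁]

end PointInteraction

end

noncomputable section

namespace PointInteraction

variable {I : Set ℤ} {J J' U N : Set ℝ} {Q : ℝ → ℝ} {x : I → ℝ} {κ κ' : Couplings I}
  {z z₁ z₂ : ℂ} {f g h : ℝ → ℂ} {q s t : ℝ}

/-! ### Existence of solutions -/

/-- The right-hand side of the first order system for `f` and its quasi-derivative. -/
def systemField (Q : ℝ → ℝ) (z : ℂ) (t : ℝ) (y : ℂ × ℂ) : ℂ × ℂ :=
  (y.2 + Q t * y.1, -z * y.1 - Q t * (y.2 + Q t * y.1))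

theorem systemField_sub (Q : ℝ → ℝ) (z : ℂ) (t : ℝ) (y y' : ℂ × ℂ) :
    systemField Q z t y - systemField Q z t y' = systemField Q z t (y - y') := by
  ext <;> simp [systemField] <;> ring

/-- As the field is linear in `y`, this bound serves both as Lipschitz constant and as growth bound
in Picard–Lindelöf. -/
theorem norm_systemField_le {B : ℝ} (hB : 0 ≤ B) (hQ : |Q t| ≤ B) (y : ℂ × ℂ) :
    ‖systemField Q z t y‖ ≤ (1 + B + ‖z‖ + B * (1 + B)) * ‖y‖ := by
  have h₁ : ‖y.1‖ ≤ ‖y‖ := norm_fst_le y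
  have h₂ : ‖y.2‖ ≤ ‖y‖ := norm_snd_le y
  have hQ' : ‖(Q t : ℂ)‖ ≤ B := by simpa using hQ
  have h₃ : ‖y.2 + Q t * y.1‖ ≤ (1 + B) * ‖y‖ :=
    calc ‖y.2 + Q t * y.1‖ ≤ ‖y.2‖ + ‖(Q t : ℂ)‖ * ‖y.1‖ := by
          simpa using norm_add_le y.2 (Q t * y.1)
      _ ≤ ‖y‖ + B * ‖y‖ := by gcongr
      _ = (1 + B) * ‖y‖ := by ring
  have h₄ : ‖-z * y.1 - Q t * (y.2 + Q t * y.1)‖ ≤ ‖z‖ * ‖y‖ + B * ((1 + B) * ‖y‖) :=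
    calc ‖-z * y.1 - Q t * (y.2 + Q t * y.1)‖
        ≤ ‖-z * y.1‖ + ‖Q t * (y.2 + Q t * y.1)‖ := norm_sub_le _ _
      _ = ‖z‖ * ‖y.1‖ + ‖(Q t : ℂ)‖ * ‖y.2 + Q t * y.1‖ := by rw [norm_mul, norm_mul, norm_neg]
      _ ≤ ‖z‖ * ‖y‖ + B * ((1 + B) * ‖y‖) := by gcongr
  have hy := norm_nonneg y
  have hz := norm_nonneg z
  rw [Prod.norm_def]
  refine max_le (h₃.trans ?_) (h₄.trans ?_)
  · refine mul_le_mul_of_nonneg_right ?_ hy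
    have := mul_nonneg hB (add_nonneg zero_le_one hB)
    linarith
  · nlinarith

/-- Local solvability of the equation without point interactions. -/
theorem exists_local_solution (hJ : IsOpen J) (hQ : ContinuousOn Q J) (hq : q ∈ J) (z l₀ l₁ : ℂ) :
    ∃ f : ℝ → ℂ, f q = l₀ ∧ deriv f q = l₁ ∧ ∀ᶠ t in 𝓝 q, DifferentiableAt ℝ f t ∧
      HasDerivAt (fun t => deriv f t - Q t * f t) (-z * f t - Q t * deriv f t) t := by
  obtain ⟨δ, hδ, hδJ⟩ := Metric.nhds_basis_closedBall.mem_iff.1 (hJ.mem_nhds hq)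
  rw [Real.closedBall_eq_Icc] at hδJ
  obtain ⟨B, hB⟩ := isCompact_Icc.exists_bound_of_continuousOn (hQ.mono hδJ)
  have hB0 : 0 ≤ B := (norm_nonneg _).trans (hB q ⟨by linarith, by linarith⟩)
  set K : ℝ := 1 + B + ‖z‖ + B * (1 + B)
  have hK : 0 ≤ K := by positivity
  -- The second component is the quasi-derivative. `L` bounds the field on the unit ball around
  -- `y₀`, and `ε` is chosen with `L ε ≤ 1` so that the solution stays in that ball.
  set y₀ : ℂ × ℂ := (l₀, l₁ - Q q * l₀)
  set L : ℝ := K * (‖y₀‖ + 1)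
  have hL : 0 ≤ L := by positivity
  set ε : ℝ := min δ (1 / (L + 1))
  have hε : 0 < ε := lt_min hδ (by positivity)
  have hεL : L * ε ≤ 1 := by
    calc L * ε ≤ L * (1 / (L + 1)) := by gcongr; exact min_le_right _ _
      _ ≤ 1 := by rw [mul_one_div, div_le_one (by positivity)]; linarith
  have hsub : Icc (q - ε) (q + ε) ⊆ Icc (q - δ) (q + δ) :=
    Icc_subset_Icc (by linarith [min_le_left δ (1 / (L + 1))])
      (by linarith [min_le_left δ (1 / (L + 1))])
  have hP : IsPicardLindelof (systemField Q z) (tmin := q - ε) (tmax := q + ε)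
      ⟨q, by linarith, by linarith⟩ y₀ 1 0 ⟨L, hL⟩ ⟨K, hK⟩ := by
    refine ⟨fun t ht => ?_, fun y _ => ?_, fun t ht y hy => ?_, ?_⟩
    · refine LipschitzOnWith.of_dist_le_mul fun y _ y' _ => ?_
      rw [dist_eq_norm, dist_eq_norm, systemField_sub]
      exact norm_systemField_le hB0 (hB t (hsub ht)) _
    · have hQ' : ContinuousOn (fun t => (Q t : ℂ)) (Icc (q - ε) (q + ε)) :=
        Complex.continuous_ofReal.comp_continuousOn (hQ.mono (hsub.trans hδJ))
      unfold systemField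
      fun_prop
    · refine (norm_systemField_le hB0 (hB t (hsub ht)) _).trans ?_
      have : ‖y‖ ≤ ‖y₀‖ + 1 := by
        have h₁ := norm_le_norm_add_norm_sub' y y₀
        have h₂ : ‖y - y₀‖ ≤ 1 := by simpa [dist_eq_norm] using hy
        linarith
      exact mul_le_mul_of_nonneg_left this hK
    · change L * max (q + ε - q) (q - (q - ε)) ≤ 1 - 0
      simpa using hεL
  obtain ⟨y, hy₀, hy⟩ := hP.exists_eq_forall_mem_Icc_hasDerivWithinAt₀
  have hnhds : ∀ᶠ t in 𝓝 q, HasDerivAt y (systemField Q z t (y t)) t := by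
    filter_upwards [Ioo_mem_nhds (show q - ε < q by linarith) (show q < q + ε by linarith)]
      with t ht
    exact (hy t (Ioo_subset_Icc_self ht)).hasDerivAt (Icc_mem_nhds ht.1 ht.2)
  have hfst : ∀ᶠ t in 𝓝 q, HasDerivAt (fun t => (y t).1) ((y t).2 + Q t * (y t).1) t :=
    hnhds.mono fun t ht => ht.fst
  have hd : ∀ᶠ t in 𝓝 q, deriv (fun t => (y t).1) t = (y t).2 + Q t * (y t).1 :=
    hfst.mono fun t ht => ht.deriv
  simp only at hy₀
  refine ⟨fun t => (y t).1, congrArg Prod.fst hy₀, ?_, ?_⟩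
  · rw [hd.self_of_nhds, hy₀]
    simp [y₀]
  · filter_upwards [hnhds, hfst, hd.eventually_nhds] with t h₁ h₂ h₃
    refine ⟨h₂.differentiableAt, ?_⟩
    have h₄ : HasDerivAt (fun t => (y t).2)
        (-z * (y t).1 - Q t * deriv (fun t => (y t).1) t) t := by
      rw [h₃.self_of_nhds]
      exact h₁.snd
    refine h₄.congr_of_eventuallyEq ?_
    filter_upwards [h₃] with r hr
    rw [hr]
    ring

/-- Local solvability with prescribed left-hand limits. -/
theorem Regular.exists_local_solution (hR : Regular J Q x κ) (hq : q ∈ J) (z l₀ l₁ : ℂ) :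
    ∃ f : ℝ → ℂ, (∀ᶠ t in 𝓝 q, SolAt Q x κ z f t) ∧ Tendsto f (𝓝[<] q) (𝓝 l₀) ∧
      Tendsto (deriv f) (𝓝[<] q) (𝓝 l₁) := by
  have hcont : ∀ f : ℝ → ℂ, (∀ᶠ t in 𝓝 q, DifferentiableAt ℝ f t ∧
      HasDerivAt (fun t => deriv f t - Q t * f t) (-z * f t - Q t * deriv f t) t) →
      ContinuousAt f q ∧ ContinuousAt (deriv f) q := by
    intro f hf
    have h₁ := hf.self_of_nhds.1.continuousAt
    have h₂ := hf.self_of_nhds.2.continuousAt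
    have h₃ : ContinuousAt (fun t => (Q t : ℂ) * f t) q :=
      (Complex.continuous_ofReal.continuousAt.comp (hR.continuousAt hq)).mul h₁
    exact ⟨h₁, (h₂.add h₃).congr (Eventually.of_forall fun t => by simp)⟩
  obtain ⟨f₁, h₁0, h₁1, hf₁⟩ := PointInteraction.exists_local_solution hR.isOpen hR.continuousOn
    hq z l₀ l₁
  have hc₁ := hcont f₁ hf₁
  by_cases hqx : q ∈ range x
  · obtain ⟨n, hn⟩ := hqx
    set A := κ.matrix n
    obtain ⟨f₂, h₂0, h₂1, hf₂⟩ := PointInteraction.exists_local_solution hR.isOpen hR.continuousOn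
      hq z (A 0 0 * l₀ + A 0 1 * l₁) (A 1 0 * l₀ + A 1 1 * l₁)
    have hc₂ := hcont f₂ hf₂
    -- The value at `q` itself is immaterial: the jump condition involves only one-sided limits.
    set f : ℝ → ℂ := fun t => if t < q then f₁ t else f₂ t
    have hl : ∀ t < q, f₁ =ᶠ[𝓝 t] f := fun t ht => by
      filter_upwards [Iio_mem_nhds ht] with r (hr : r < q)
      simp [f, hr]
    have hr : ∀ t > q, f₂ =ᶠ[𝓝 t] f := fun t ht => by
      filter_upwards [Ioi_mem_nhds ht] with r (hr : q < r)
      simp [f, hr.not_gt]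
    have hL₀ : Tendsto f (𝓝[<] q) (𝓝 l₀) := by
      rw [← h₁0]
      refine (hc₁.1.mono_left nhdsWithin_le_nhds).congr' ?_
      filter_upwards [self_mem_nhdsWithin] with t ht using (hl t ht).eq_of_nhds
    have hL₁ : Tendsto (deriv f) (𝓝[<] q) (𝓝 l₁) := by
      rw [← h₁1]
      refine (hc₁.2.mono_left nhdsWithin_le_nhds).congr' ?_
      filter_upwards [self_mem_nhdsWithin] with t ht using (hl t ht).deriv_eq
    refine ⟨f, ?_, hL₀, hL₁⟩
    have hd := hR.discrete q hq
    rw [eventually_nhdsWithin_iff] at hd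
    filter_upwards [hd, hf₁, hf₂] with t h₁ h₂ h₃
    rcases lt_trichotomy t q with htq | rfl | htq
    · have htx := h₁ htq.ne
      exact SolAt.congr (hl t htq) ⟨fun _ => h₂, fun m hm => (htx ⟨m, hm⟩).elim⟩
    · refine ⟨fun h => (h ⟨n, hn⟩).elim, fun m hm => ?_⟩
      obtain rfl := hR.injective (hm.trans hn.symm)
      refine jumpCondition_iff.2 ⟨l₀, l₁, hL₀, hL₁, ?_, ?_⟩
      · rw [← h₂0]
        refine (hc₂.1.mono_left nhdsWithin_le_nhds).congr' ?_
        filter_upwards [self_mem_nhdsWithin] with r hr' using (hr r hr').eq_of_nhds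
      · rw [← h₂1]
        refine (hc₂.2.mono_left nhdsWithin_le_nhds).congr' ?_
        filter_upwards [self_mem_nhdsWithin] with r hr' using (hr r hr').deriv_eq
    · have htx := h₁ htq.ne'
      exact SolAt.congr (hr t htq) ⟨fun _ => h₃, fun m hm => (htx ⟨m, hm⟩).elim⟩
  · refine ⟨f₁, ?_, ?_, ?_⟩
    · filter_upwards [hR.isOpen_diff.mem_nhds ⟨hq, hqx⟩, hf₁] with t h₁ h₂
      exact ⟨fun _ => h₂, fun m hm => (h₁.2 ⟨m, hm⟩).elim⟩
    · rw [← h₁0]; exact hc₁.1.mono_left nhdsWithin_le_nhds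
    · rw [← h₁1]; exact hc₁.2.mono_left nhdsWithin_le_nhds

/-! ### Fundamental systems, from local to global. -/

/-- There is a fundamental system of solutions on `U`. -/
def HasFundamentalSystem (U : Set ℝ) (Q : ℝ → ℝ) (x : I → ℝ) (κ : Couplings I) (z : ℂ) : Prop :=
  ∃ u₁ u₂ : ℝ → ℂ, SolOn U Q x κ z u₁ ∧ SolOn U Q x κ z u₂ ∧
    ∀ t ∈ U \ range x, wronskian u₁ u₂ t ≠ 0

theorem HasFundamentalSystem.mono (h : HasFundamentalSystem U Q x κ z) (hN : N ⊆ U) :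
    HasFundamentalSystem N Q x κ z := by
  obtain ⟨u₁, u₂, h₁, h₂, h₃⟩ := h
  exact ⟨u₁, u₂, h₁.mono hN, h₂.mono hN, fun t ht => h₃ t ⟨hN ht.1, ht.2⟩⟩

theorem HasFundamentalSystem.eqOn (hR : Regular U Q x κ) (h : HasFundamentalSystem U Q x κ z)
    (hf : SolOn U Q x κ z f) (hg : SolOn U Q x κ z g) (hs : s ∈ U \ range x)
    (h₀ : f s = g s) (h₁ : deriv f s = deriv g s) : EqOn f g (U \ range x) := by
  obtain ⟨u₁, u₂, hu₁, hu₂, hw⟩ := h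
  exact SolOn.eqOn_of_fundamental hR hu₁ hu₂ hf hg hs (hw s hs) h₀ h₁

theorem HasFundamentalSystem.exists_data (hR : Regular U Q x κ)
    (h : HasFundamentalSystem U Q x κ z) (hs : s ∈ U \ range x) (l₀ l₁ : ℂ) :
    ∃ f, SolOn U Q x κ z f ∧ f s = l₀ ∧ deriv f s = l₁ := by
  obtain ⟨u₁, u₂, hu₁, hu₂, hw⟩ := h
  have hws := hw s hs
  refine ⟨_, hu₁.linearCombination hR hu₂
    ((l₀ * deriv u₂ s - l₁ * u₂ s) / wronskian u₁ u₂ s)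
    (-(l₀ * deriv u₁ s - l₁ * u₁ s) / wronskian u₁ u₂ s), ?_, ?_⟩
  · field_simp
    simp only [wronskian]
    ring
  · rw [hu₁.deriv_linearCombination hu₂ _ _ hs]
    field_simp
    simp only [wronskian]
    ring

theorem Regular.exists_nhds_hasFundamentalSystem (hR : Regular J Q x κ) (hq : q ∈ J) (z : ℂ) :
    ∃ U, IsOpen U ∧ U.OrdConnected ∧ U ⊆ J ∧ q ∈ U ∧ HasFundamentalSystem U Q x κ z := by
  obtain ⟨u₁, h₁, h₁0, h₁1⟩ := hR.exists_local_solution hq z 1 0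
  obtain ⟨u₂, h₂, h₂0, h₂1⟩ := hR.exists_local_solution hq z 0 1
  obtain ⟨ε, hε, hεs⟩ := Metric.eventually_nhds_iff_ball.1
    ((hR.isOpen.eventually_mem hq).and (h₁.and h₂))
  rw [Real.ball_eq_Ioo] at hεs
  have hqU : q ∈ Ioo (q - ε) (q + ε) := ⟨by linarith, by linarith⟩
  have hRU : Regular (Ioo (q - ε) (q + ε)) Q x κ :=
    hR.mono isOpen_Ioo ordConnected_Ioo fun t ht => (hεs _ ht).1
  have hu₁ : SolOn (Ioo (q - ε) (q + ε)) Q x κ z u₁ := fun t ht => (hεs _ ht).2.1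
  have hu₂ : SolOn (Ioo (q - ε) (q + ε)) Q x κ z u₂ := fun t ht => (hεs _ ht).2.2
  refine ⟨_, isOpen_Ioo, ordConnected_Ioo, fun t ht => (hεs _ ht).1, hqU, u₁, u₂, hu₁, hu₂, ?_⟩
  -- The left-hand data `(1, 0)` and `(0, 1)` make the Wronskian tend to 1; being constant off the
  -- interaction points, it vanishes at none of them.
  have hW : Tendsto (wronskian u₁ u₂) (𝓝[<] q) (𝓝 (1 * 1 - 0 * 0)) :=
    (h₁0.mul h₂1).sub (h₁1.mul h₂0)
  have hne : ∀ᶠ t in 𝓝[<] q, wronskian u₁ u₂ t ≠ 0 := hW.eventually_ne (by norm_num)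
  obtain ⟨s, hs₁, hs₂⟩ := (hne.and ((hRU.eventually_diff hqU).filter_mono
    (nhdsWithin_mono q fun t (ht : t < q) => ht.ne))).exists
  intro t ht
  rwa [hu₁.wronskian_eq hRU hu₂ hs₂ ht]

/-- Each member of the system on `U` is continued by the solution on `N` with the same data at a
common regular point `s`; uniqueness on the connected overlap makes the two agree there. -/
theorem HasFundamentalSystem.union (hR : Regular J Q x κ) (hU : IsOpen U) (hUo : U.OrdConnected)
    (hUJ : U ⊆ J) (hN : IsOpen N) (hNo : N.OrdConnected) (hNJ : N ⊆ J)
    (hfU : HasFundamentalSystem U Q x κ z) (hfN : HasFundamentalSystem N Q x κ z)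
    (hne : (U ∩ N).Nonempty) : HasFundamentalSystem (U ∪ N) Q x κ z := by
  have hRU := hR.mono hU hUo hUJ
  have hRN := hR.mono hN hNo hNJ
  have hRi := hR.mono (hU.inter hN) (hUo.inter hNo) (inter_subset_left.trans hUJ)
  have hRu : Regular (U ∪ N) Q x κ := by
    refine hR.mono (hU.union hN) ?_ (union_subset hUJ hNJ)
    rw [← isPreconnected_iff_ordConnected] at *
    exact hUo.union' hne hNo
  obtain ⟨r, hr⟩ := hne
  obtain ⟨s, hs⟩ := closure_nonempty_iff.1 ⟨r, hRi.subset_closure hr⟩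
  have hsU : s ∈ U \ range x := ⟨hs.1.1, hs.2⟩
  have hsN : s ∈ N \ range x := ⟨hs.1.2, hs.2⟩
  have key : ∀ u, SolOn U Q x κ z u → ∃ v, SolOn (U ∪ N) Q x κ z v ∧ EqOn u v U := by
    intro u hu
    obtain ⟨v, hv, hv₀, hv₁⟩ := hfN.exists_data hRN hsN (u s) (deriv u s)
    have heq : EqOn u v ((U ∩ N) \ range x) :=
      (hfN.mono inter_subset_right).eqOn hRi (hu.mono inter_subset_left)
        (hv.mono inter_subset_right) hs hv₀.symm hv₁.symm
    classical
    have hE : EqOn u (fun t => if t ∈ U then u t else v t) U := fun t ht => by simp [ht]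
    refine ⟨fun t => if t ∈ U then u t else v t, ?_, hE⟩
    intro q hq
    by_cases hqU : q ∈ U
    · exact (hu q hqU).congr (hE.eventuallyEq_of_mem (hU.mem_nhds hqU))
    · have hqN : q ∈ N := hq.resolve_left hqU
      refine (hv q hqN).congr ?_
      have hd := hRN.eventually_diff hqN
      rw [eventually_nhdsWithin_iff] at hd
      -- Near a point `q` of `N` outside `U` the two pieces agree at every `t ≠ q`, such `t` being
      -- regular; at `q` itself the definition selects `v`.
      filter_upwards [hd] with t ht
      by_cases htU : t ∈ U
      · have htq : t ≠ q := fun h => hqU (h ▸ htU)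
        simp only [htU, if_true]
        exact (heq ⟨⟨htU, (ht htq).1⟩, (ht htq).2⟩).symm
      · simp [htU]
  obtain ⟨u₁, u₂, hu₁, hu₂, hw⟩ := hfU
  obtain ⟨v₁, hv₁, he₁⟩ := key u₁ hu₁
  obtain ⟨v₂, hv₂, he₂⟩ := key u₂ hu₂
  refine ⟨v₁, v₂, hv₁, hv₂, fun t ht => ?_⟩
  rw [hv₁.wronskian_eq hRu hv₂ ⟨Or.inl hsU.1, hsU.2⟩ ht]
  have e₁ := he₁.eventuallyEq_of_mem (hU.mem_nhds hsU.1)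
  have e₂ := he₂.eventuallyEq_of_mem (hU.mem_nhds hsU.1)
  have := hw s hsU
  simpa only [wronskian, e₁.eq_of_nhds, e₁.deriv_eq, e₂.eq_of_nhds, e₂.deriv_eq] using this

/-- Connectedness of `J`: the points that share with `s` an interval carrying a fundamental system
form a set that is open and relatively closed. -/
theorem Regular.exists_hasFundamentalSystem (hR : Regular J Q x κ) (hs : s ∈ J) (ht : t ∈ J)
    (z : ℂ) : ∃ U, IsOpen U ∧ U.OrdConnected ∧ U ⊆ J ∧ s ∈ U ∧ t ∈ U ∧
      HasFundamentalSystem U Q x κ z := by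
  set T := {t | ∃ U, IsOpen U ∧ U.OrdConnected ∧ U ⊆ J ∧ s ∈ U ∧ t ∈ U ∧
      HasFundamentalSystem U Q x κ z}
  have hJc : IsPreconnected J := hR.ordConnected.isPreconnected
  have hT : IsOpen T := by
    rw [isOpen_iff_mem_nhds]
    rintro t ⟨U, h₁, h₂, h₃, h₄, h₅, h₆⟩
    filter_upwards [h₁.mem_nhds h₅] with r hr using ⟨U, h₁, h₂, h₃, h₄, hr, h₆⟩
  refine hJc.subset_of_closure_inter_subset hT ⟨s, hs, ?_⟩ ?_ ht
  · obtain ⟨U, h₁, h₂, h₃, h₄, h₅⟩ := hR.exists_nhds_hasFundamentalSystem hs z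
    exact ⟨U, h₁, h₂, h₃, h₄, h₄, h₅⟩
  · rintro t ⟨htc, htJ⟩
    obtain ⟨N, h₁, h₂, h₃, h₄, h₅⟩ := hR.exists_nhds_hasFundamentalSystem htJ z
    obtain ⟨r, hrN, U, k₁, k₂, k₃, k₄, k₅, k₆⟩ := mem_closure_iff.1 htc N h₁ h₄
    refine ⟨U ∪ N, k₁.union h₁, ?_, union_subset k₃ h₃, Or.inl k₄, Or.inr h₄,
      k₆.union hR k₁ k₂ k₃ h₁ h₂ h₃ h₅ ⟨r, k₅, hrN⟩⟩
    rw [← isPreconnected_iff_ordConnected] at *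
    exact k₂.union' ⟨r, k₅, hrN⟩ h₂

/-- Initial value problems are solvable on the whole interval. -/
theorem Regular.exists_solution (hR : Regular J Q x κ) (hs : s ∈ J \ range x) (z l₀ l₁ : ℂ) :
    ∃ f, SolOn J Q x κ z f ∧ f s = l₀ ∧ deriv f s = l₁ := by
  classical
  have hex : ∀ t : J, ∃ U f, IsOpen U ∧ U.OrdConnected ∧ U ⊆ J ∧ s ∈ U ∧ (t : ℝ) ∈ U ∧
      HasFundamentalSystem U Q x κ z ∧ SolOn U Q x κ z f ∧ f s = l₀ ∧ deriv f s = l₁ := by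
    intro t
    obtain ⟨U, h₁, h₂, h₃, h₄, h₅, h₆⟩ := hR.exists_hasFundamentalSystem hs.1 t.2 z
    obtain ⟨f, hf⟩ := h₆.exists_data (hR.mono h₁ h₂ h₃) ⟨h₄, hs.2⟩ l₀ l₁
    exact ⟨U, f, h₁, h₂, h₃, h₄, h₅, h₆, hf⟩
  choose U F hU hUo hUJ hsU htU hfs hF hF₀ hF₁ using hex
  -- Diagonal gluing: each point uses the solution from its own neighbourhood. Any two of these
  -- agree at regular points of the overlap, because they share the data at `s`.
  set f : ℝ → ℂ := fun t => if ht : t ∈ J then F ⟨t, ht⟩ t else 0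
  have hfF : ∀ q : J, F q =ᶠ[𝓝 (q : ℝ)] f := by
    intro q
    have hd := hR.eventually_diff q.2
    rw [eventually_nhdsWithin_iff] at hd
    filter_upwards [hd, (hU q).mem_nhds (htU q)] with t ht htq
    by_cases h : t = q
    · subst h
      simp [f]
    · have htJ := ht h
      have hRi := hR.mono ((hU q).inter (hU ⟨t, htJ.1⟩)) ((hUo q).inter (hUo ⟨t, htJ.1⟩))
        (inter_subset_left.trans (hUJ q))
      have := ((hfs q).mono inter_subset_left).eqOn hRi ((hF q).mono inter_subset_left)
        ((hF ⟨t, htJ.1⟩).mono inter_subset_right) ⟨⟨hsU q, hsU _⟩, hs.2⟩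
        ((hF₀ q).trans (hF₀ _).symm) ((hF₁ q).trans (hF₁ _).symm)
        ⟨⟨htq, htU ⟨t, htJ.1⟩⟩, htJ.2⟩
      simp only [f, htJ.1, dif_pos]
      exact this
  refine ⟨f, fun q hq => (hF ⟨q, hq⟩ q (htU ⟨q, hq⟩)).congr (hfF ⟨q, hq⟩), ?_, ?_⟩
  · rw [← (hfF ⟨s, hs.1⟩).eq_of_nhds]; exact hF₀ _
  · rw [← (hfF ⟨s, hs.1⟩).deriv_eq]; exact hF₁ _

theorem Regular.hasFundamentalSystem (hR : Regular J Q x κ) (z : ℂ) :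
    HasFundamentalSystem J Q x κ z := by
  rcases (J \ range x).eq_empty_or_nonempty with he | ⟨s, hs⟩
  · have hJ : J = ∅ := by
      rw [eq_empty_iff_forall_notMem]
      intro q hq
      simpa [he] using hR.subset_closure hq
    exact ⟨0, 0, by simp [hJ, SolOn], by simp [hJ, SolOn], by simp [hJ]⟩
  · obtain ⟨u₁, h₁, h₁0, h₁1⟩ := hR.exists_solution hs z 1 0
    obtain ⟨u₂, h₂, h₂0, h₂1⟩ := hR.exists_solution hs z 0 1
    refine ⟨u₁, u₂, h₁, h₂, fun t ht => ?_⟩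
    rw [h₁.wronskian_eq hR h₂ hs ht]
    simp [wronskian, h₁0, h₁1, h₂0, h₂1]

end PointInteraction

end

noncomputable section

namespace PointInteraction

variable {I : Set ℤ} {J : Set ℝ} {Q : ℝ → ℝ} {x : I → ℝ} {κ : Couplings I}
  {z : ℂ} {f g : ℝ → ℂ} {q s t : ℝ}

/-! ### Equivalence of the two solution concepts -/

theorem absolutelyContinuousOnInterval_of_hasDerivAt {F G : ℝ → ℂ} {c d : ℝ} (hcd : c ≤ d)
    (hF : ∀ t ∈ Icc c d, HasDerivAt F (G t) t) (hG : ContinuousOn G (Icc c d)) :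
    AbsolutelyContinuousOnInterval F c d := by
  obtain ⟨C, hC⟩ := isCompact_Icc.exists_bound_of_continuousOn hG
  have hL : LipschitzOnWith C.toNNReal F (Icc c d) := by
    refine (convex_Icc c d).lipschitzOnWith_of_nnnorm_hasDerivWithin_le
      (fun t ht => (hF t ht).hasDerivWithinAt) fun t ht => ?_
    rw [← NNReal.coe_le_coe]
    exact (hC t ht).trans (Real.le_coe_toNNReal C)
  rw [← uIcc_of_le hcd] at hL
  exact hL.absolutelyContinuousOnInterval

/-- An absolutely continuous function whose derivative agrees almost everywhere with a continuous
function is continuously differentiable. -/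
theorem hasDerivAt_of_ae_hasDerivAt {F G : ℝ → ℂ} {c d : ℝ} (hcd : c ≤ d)
    (hF : AbsolutelyContinuousOnInterval F c d) (hG : ContinuousOn G (Icc c d))
    (hFG : ∀ᵐ t, t ∈ Icc c d → HasDerivAt F (G t) t) (ht : t ∈ Ioo c d) :
    HasDerivAt F (G t) t := by
  -- Extending `G` continuously to the whole line makes its primitive `P` differentiable everywhere.
  -- Then `F - P` is absolutely continuous with derivative zero almost everywhere, hence constant.
  set G' : ℝ → ℂ := IccExtend hcd ((Icc c d).domRestrict G)
  have hG' : Continuous G' := (continuousOn_iff_continuous_domRestrict.1 hG).Icc_extend'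
  have hGG' : ∀ t ∈ Icc c d, G' t = G t := fun t ht => IccExtend_of_mem hcd _ ht
  set P : ℝ → ℂ := fun t => ∫ r in c..t, G' r
  have hP : ∀ t, HasDerivAt P (G' t) t := fun t => (hG'.integral_hasStrictDerivAt c t).hasDerivAt
  have hPac : AbsolutelyContinuousOnInterval P c d :=
    absolutelyContinuousOnInterval_of_hasDerivAt hcd (fun t _ => hP t) hG'.continuousOn
  obtain ⟨C, hC⟩ := (hF.sub hPac).const_of_ae_hasDerivAt_zero (by
    filter_upwards [hFG] with t h ht
    rw [uIcc_of_le hcd] at ht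
    have := (h ht).sub (hP t)
    rwa [hGG' t ht, sub_self] at this)
  rw [← hGG' t (Ioo_subset_Icc_self ht)]
  refine ((hP t).const_add C).congr_of_eventuallyEq ?_
  filter_upwards [Ioo_mem_nhds ht.1 ht.2] with r hr
  rw [← hC r (by rw [uIcc_of_le hcd]; exact Ioo_subset_Icc_self hr)]
  simp

/-- A property that holds locally almost everywhere holds almost everywhere. -/
theorem ae_of_locally {J : Set ℝ} {P : ℝ → Prop}
    (h : ∀ q ∈ J, ∃ u ∈ 𝓝 q, ∀ᵐ t, t ∈ u → P t) : ∀ᵐ t, t ∈ J → P t := by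
  rw [ae_iff]
  refine measure_null_of_locally_null _ fun q hq => ?_
  simp only [mem_ofPred_eq, Classical.not_imp] at hq
  obtain ⟨u, hu, hP⟩ := h q hq.1
  refine ⟨u ∩ {t | ¬(t ∈ J → P t)}, inter_mem (nhdsWithin_le_nhds hu) self_mem_nhdsWithin, ?_⟩
  rw [ae_iff] at hP
  refine measure_mono_null ?_ hP
  rintro t ⟨h₁, h₂⟩
  simp only [mem_ofPred_eq, Classical.not_imp] at h₂ ⊢
  exact ⟨h₁, h₂.2⟩

theorem isOpen_interval (a b : EReal) : IsOpen (interval a b) :=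
  (isOpen_Ioo (a := a) (b := b)).preimage continuous_coe_real_ereal

theorem ordConnected_interval (a b : EReal) : (interval a b).OrdConnected :=
  ⟨fun _ hs _ ht _ hr => ⟨hs.1.trans_le (EReal.coe_le_coe_iff.2 hr.1),
    (EReal.coe_le_coe_iff.2 hr.2).trans_lt ht.2⟩⟩

theorem interval_subset_interval {a b a' b' : EReal} (ha : a ≤ a') (hb : b' ≤ b) :
    interval a' b' ⊆ interval a b :=
  fun _ ht => ⟨ha.trans_lt ht.1, ht.2.trans_le hb⟩

/-! ### The primitive of the potential, and passage from the almost everywhere equation to the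
pointwise one. -/

section Primitive

variable {V : ℝ → ℝ} {c : ℝ}

/-- The primitive of the potential that vanishes at `c`. -/
def primitive (V : ℝ → ℝ) (c t : ℝ) : ℝ := ∫ r in c..t, V r

theorem absolutelyContinuousOnInterval_primitive (hJo : J.OrdConnected)
    (hV : LocallyIntegrableOn V J) (hc : c ∈ J) (hs : s ∈ J) (ht : t ∈ J) :
    AbsolutelyContinuousOnInterval (primitive V c) s t := by
  have h₁ : min c (min s t) ∈ J := by
    rcases min_choice c (min s t) with h | h <;> rw [h]
    · exact hc
    · rcases min_choice s t with h | h <;> rw [h] <;> assumption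
  have h₂ : max c (max s t) ∈ J := by
    rcases max_choice c (max s t) with h | h <;> rw [h]
    · exact hc
    · rcases max_choice s t with h | h <;> rw [h] <;> assumption
  have hle : min c (min s t) ≤ max c (max s t) := (min_le_left _ _).trans (le_max_left _ _)
  have hi : IntervalIntegrable V volume (min c (min s t)) (max c (max s t)) :=
    (hV.integrableOn_compact_subset (hJo.uIcc_subset h₁ h₂) isCompact_uIcc).intervalIntegrable
  refine (hi.absolutelyContinuousOnInterval_intervalIntegral (c := c) ?_).mono ?_
  · rw [uIcc_of_le hle]
    exact ⟨min_le_left _ _, le_max_left _ _⟩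
  · rw [uIcc_of_le hle]
    exact Icc_subset_Icc (min_le_right _ _) (le_max_right _ _)

theorem ae_hasDerivAt_primitive (hJ : IsOpen J) (hJo : J.OrdConnected)
    (hV : LocallyIntegrableOn V J) (hc : c ∈ J) :
    ∀ᵐ t, t ∈ J → HasDerivAt (primitive V c) (V t) t := by
  refine ae_of_locally fun q hq => ?_
  obtain ⟨δ, hδ, hδJ⟩ := Metric.nhds_basis_closedBall.mem_iff.1 (hJ.mem_nhds hq)
  rw [Real.closedBall_eq_Icc] at hδJ
  have h₁ : min c (q - δ) ∈ J := by
    rcases min_choice c (q - δ) with h | h <;> rw [h]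
    exacts [hc, hδJ ⟨le_rfl, by linarith⟩]
  have h₂ : max c (q + δ) ∈ J := by
    rcases max_choice c (q + δ) with h | h <;> rw [h]
    exacts [hc, hδJ ⟨by linarith, le_rfl⟩]
  have hle : min c (q - δ) ≤ max c (q + δ) := (min_le_left _ _).trans (le_max_left _ _)
  have hi : IntervalIntegrable V volume (min c (q - δ)) (max c (q + δ)) :=
    (hV.integrableOn_compact_subset (hJo.uIcc_subset h₁ h₂) isCompact_uIcc).intervalIntegrable
  refine ⟨Icc (q - δ) (q + δ), Icc_mem_nhds (by linarith) (by linarith), ?_⟩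
  filter_upwards [hi.ae_hasDerivAt_integral] with t h ht
  rw [uIcc_of_le hle] at h
  exact h ⟨(min_le_right _ _).trans ht.1, ht.2.trans (le_max_right _ _)⟩ c
    ⟨min_le_left _ _, le_max_left _ _⟩

theorem continuousOn_primitive (hJ : IsOpen J) (hJo : J.OrdConnected)
    (hV : LocallyIntegrableOn V J) (hc : c ∈ J) : ContinuousOn (primitive V c) J := by
  intro q hq
  obtain ⟨δ, hδ, hδJ⟩ := Metric.nhds_basis_closedBall.mem_iff.1 (hJ.mem_nhds hq)
  rw [Real.closedBall_eq_Icc] at hδJ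
  have h := (absolutelyContinuousOnInterval_primitive hJo hV hc
    (hδJ ⟨le_rfl, by linarith⟩ : q - δ ∈ J) (hδJ ⟨by linarith, le_rfl⟩ : q + δ ∈ J)).continuousOn
  rw [uIcc_of_le (by linarith)] at h
  exact (h.continuousAt (Icc_mem_nhds (by linarith) (by linarith))).continuousWithinAt

theorem det_matrix (n : I) (hr : 0 < κ.r n) : (κ.matrix n).det = 1 := by
  rw [Couplings.matrix, interactionMatrix, Matrix.det_mul, Matrix.det_mul, parabolic, hyperbolic,
    elliptic, Matrix.det_fin_two_of, Matrix.det_fin_two_of, Matrix.det_fin_two_of]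
  have := Real.sin_sq_add_cos_sq (κ.theta n)
  field_simp
  linear_combination this

theorem regular_interval {a b : EReal} (hV : LocallyIntegrableOn V (interval a b))
    (hx_inj : Function.Injective x)
    (hx_acc : ∀ p ∈ interval a b, ¬ AccPt p (𝓟 (range x)))
    (hr : ∀ n, 0 < κ.r n) (hc : c ∈ interval a b) :
    Regular (interval a b) (primitive V c) x κ where
  isOpen := isOpen_interval a b
  ordConnected := ordConnected_interval a b
  discrete q hq := by
    have := hx_acc q hq
    rwa [accPt_iff_frequently_nhdsNE, not_frequently] at this
  continuousOn := continuousOn_primitive (isOpen_interval a b) (ordConnected_interval a b) hV hc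
  det n := det_matrix n (hr n)
  injective := hx_inj

/-- Away from interaction points, `f` and `f' - Q f` are absolutely continuous with almost
everywhere derivatives given by continuous functions, so both are differentiable everywhere. -/
theorem IsSolution.solOn {a b a' b' : EReal} (hV : LocallyIntegrableOn V (interval a b))
    (hc : c ∈ interval a b) (hsub : interval a' b' ⊆ interval a b)
    (hR : Regular (interval a' b') (primitive V c) x κ) (hf : IsSolution a' b' V x κ z f) :
    SolOn (interval a' b') (primitive V c) x κ z f := by
  intro q hq
  refine ⟨fun hqx => ?_, fun n hn => hn ▸ hf.1.2.2 n (hn ▸ hq)⟩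
  obtain ⟨δ, hδ, hδJ⟩ := Metric.nhds_basis_closedBall.mem_iff.1
    (hR.isOpen_diff.mem_nhds ⟨hq, hqx⟩)
  rw [Real.closedBall_eq_Icc] at hδJ
  have hle : q - δ ≤ q + δ := by linarith
  have hqI : q ∈ Ioo (q - δ) (q + δ) := ⟨by linarith, by linarith⟩
  have h₁ := hf.1.1 _ _ hle hδJ
  have h₂ := hf.1.2.1 _ _ hle hδJ
  have hsubJ : Icc (q - δ) (q + δ) ⊆ interval a b := fun t ht => hsub (hδJ ht).1
  have h₃ := absolutelyContinuousOnInterval_primitive (ordConnected_interval a b) hV hc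
    (hsubJ (left_mem_Icc.2 hle)) (hsubJ (right_mem_Icc.2 hle))
  have c₁ := h₁.continuousOn
  have c₂ := h₂.continuousOn
  have c₃ := h₃.continuousOn
  have d₁ := h₁.boundedVariationOn.ae_differentiableAt_of_mem_uIcc
  have d₂ := h₂.boundedVariationOn.ae_differentiableAt_of_mem_uIcc
  rw [uIcc_of_le hle] at c₁ c₂ c₃ d₁ d₂
  have hfd : ∀ t ∈ Ioo (q - δ) (q + δ), HasDerivAt f (deriv f t) t := fun t ht =>
    hasDerivAt_of_ae_hasDerivAt hle h₁ c₂ (d₁.mono fun t h ht => (h ht).hasDerivAt) ht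
  refine ⟨(hfd q hqI).differentiableAt, ?_⟩
  have c₄ : ContinuousOn (fun t => (primitive V c t : ℂ)) (Icc (q - δ) (q + δ)) :=
    Complex.continuous_ofReal.comp_continuousOn c₃
  have hac : AbsolutelyContinuousOnInterval (fun t => deriv f t - primitive V c t * f t)
      (q - δ) (q + δ) := by
    have h := h₂.sub (h₃.smul h₁)
    have heq : deriv f - primitive V c • f = fun t => deriv f t - primitive V c t * f t := by
      funext t
      simp
    rwa [heq] at h
  refine hasDerivAt_of_ae_hasDerivAt (G := fun t => -z * f t - primitive V c t * deriv f t)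
    hle hac ?_ ?_ hqI
  · fun_prop
  · have hτ := hf.2
    rw [ae_restrict_iff' (isOpen_interval a' b').measurableSet] at hτ
    filter_upwards [hτ, d₁, d₂, ae_hasDerivAt_primitive (isOpen_interval a b)
      (ordConnected_interval a b) hV hc] with t e₁ e₂ e₃ e₄ ht
    have e₁' := e₁ (hδJ ht).1
    simp only [tau] at e₁'
    -- Almost everywhere `(f' - Q f)' = f'' - V f - Q f'`, and the equation turns `f'' - V f` into
    -- `-z f`.
    refine ((e₃ ht).hasDerivAt.sub ((e₄ (hsubJ ht)).ofReal_comp.mul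
      (e₂ ht).hasDerivAt)).congr_deriv ?_
    linear_combination -e₁'

/-- `f'` is recovered as the quasi-derivative plus `Q f`, both absolutely continuous; the equation
returns wherever `Q' = V`. -/
theorem SolOn.isSolution {a b a' b' : EReal} (hV : LocallyIntegrableOn V (interval a b))
    (hc : c ∈ interval a b) (hsub : interval a' b' ⊆ interval a b)
    (hR : Regular (interval a' b') (primitive V c) x κ)
    (hf : SolOn (interval a' b') (primitive V c) x κ z f) : IsSolution a' b' V x κ z f := by
  have hf₁ : LocallyAC f (interval a' b' \ range x) := fun s t hst hI =>
    absolutelyContinuousOnInterval_of_hasDerivAt hst (fun r hr => hf.hasDerivAt (hI hr))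
      ((hf.continuousOn_deriv hR).mono hI)
  refine ⟨⟨hf₁, fun s t hst hI => ?_, fun n hn => (hf _ hn).2 n rfl⟩, ?_⟩
  · have h₃ := absolutelyContinuousOnInterval_primitive (ordConnected_interval a b) hV hc
      (hsub (hI (left_mem_Icc.2 hst)).1) (hsub (hI (right_mem_Icc.2 hst)).1)
    have c₁ := hf.continuousOn.mono hI
    have c₂ := (hf.continuousOn_deriv hR).mono hI
    have c₄ : ContinuousOn (fun t => (primitive V c t : ℂ)) (Icc s t) :=
      Complex.continuous_ofReal.comp_continuousOn (hR.continuousOn.mono fun r hr => (hI hr).1)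
    have h₄ : AbsolutelyContinuousOnInterval (fun t => deriv f t - primitive V c t * f t) s t :=
      absolutelyContinuousOnInterval_of_hasDerivAt hst
        (fun r hr => ((hf r (hI hr).1).1 (hI hr).2).2) (by fun_prop)
    have h := h₄.add (h₃.smul (hf₁ s t hst hI))
    have heq : (fun t => deriv f t - primitive V c t * f t) + primitive V c • f = deriv f := by
      funext t
      simp
    rwa [heq] at h
  · rw [ae_restrict_iff' (isOpen_interval a' b').measurableSet]
    filter_upwards [ae_hasDerivAt_primitive (isOpen_interval a b) (ordConnected_interval a b) hV hc,
      ae_notMem_range x volume Measure.AbsolutelyContinuous.rfl] with t h₁ h₂ ht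
    have h₃ := ((hf t ht).1 h₂).2
    have h₄ := (h₁ (hsub ht)).ofReal_comp.mul (hf.hasDerivAt ⟨ht, h₂⟩)
    have h₅ : HasDerivAt (deriv f) _ t := (h₃.add h₄).congr_of_eventuallyEq
      (Eventually.of_forall fun r => by simp)
    simp only [tau]
    rw [h₅.deriv]
    ring

end Primitive

end PointInteraction

end

noncomputable section

namespace PointInteraction

variable {I : Set ℤ} {J : Set ℝ} {Q : ℝ → ℝ} {x : I → ℝ} {κ : Couplings I}
  {z e w : ℂ} {f₁ f₂ g : ℝ → ℂ} {q s t : ℝ}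

/-! ### Variation of constants near an end point -/

/-- The size of the coefficients of `g` in its expansion with respect to `f₁`, `f₂`. -/
def coeffNorm (g f₁ f₂ : ℝ → ℂ) (t : ℝ) : ℝ := ‖wronskian g f₁ t‖ + ‖wronskian g f₂ t‖

/-- By Cramer's rule `w g` is a combination of `f₁` and `f₂` with Wronskians of `g` as coefficients.
-/
theorem norm_mul_norm_le_coeffNorm (hw : wronskian f₁ f₂ t = w) :
    ‖w‖ * ‖g t‖ ≤ coeffNorm g f₁ f₂ t * (‖f₁ t‖ + ‖f₂ t‖) := by
  have h := wronskian_mul_eq g f₁ f₂ t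
  rw [hw] at h
  rw [← norm_mul, h]
  refine (norm_sub_le _ _).trans ?_
  rw [norm_mul, norm_mul, coeffNorm]
  have h₁ : 0 ≤ ‖wronskian g f₁ t‖ * ‖f₁ t‖ := by positivity
  have h₂ : 0 ≤ ‖wronskian g f₂ t‖ * ‖f₂ t‖ := by positivity
  nlinarith

theorem eq_zero_of_coeffNorm_eq_zero (hw : wronskian f₁ f₂ t ≠ 0) (h : coeffNorm g f₁ f₂ t = 0) :
    g t = 0 ∧ deriv g t = 0 := by
  rw [coeffNorm, add_eq_zero_iff_of_nonneg (norm_nonneg _) (norm_nonneg _), norm_eq_zero,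
    norm_eq_zero] at h
  have h₁ := wronskian_mul_eq g f₁ f₂ t
  have h₂ := wronskian_mul_deriv_eq g f₁ f₂ t
  rw [h.1, h.2, zero_mul, zero_mul, sub_zero] at h₁ h₂
  exact ⟨(mul_eq_zero.1 h₁).resolve_left hw, (mul_eq_zero.1 h₂).resolve_left hw⟩

/-- If the square integrals of `f₁`, `f₂` are small on `J`, the coefficients of a solution for
another spectral parameter vary at most by a factor of two on `J`. -/
theorem coeffNorm_le_two_mul (hR : Regular J Q x κ) (hf₁ : SolOn J Q x κ e f₁)
    (hf₂ : SolOn J Q x κ e f₂) (hg : SolOn J Q x κ z g)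
    (hw : ∀ t ∈ J \ range x, wronskian f₁ f₂ t = w) (hw0 : w ≠ 0)
    (hF : IntegrableOn (fun t => (‖f₁ t‖ + ‖f₂ t‖) ^ 2) J)
    (hsmall : ‖z - e‖ / ‖w‖ * ∫ t in J, (‖f₁ t‖ + ‖f₂ t‖) ^ 2 ≤ 1 / 2)
    (hs : s ∈ J \ range x) (ht : t ∈ J \ range x) :
    coeffNorm g f₁ f₂ s ≤ 2 * coeffNorm g f₁ f₂ t := by
  set N := coeffNorm g f₁ f₂
  have hwpos : 0 < ‖w‖ := norm_pos_iff.2 hw0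
  have hN : ∀ r, 0 ≤ N r := fun r => by simp only [N, coeffNorm]; positivity
  have hKJ : uIcc t s ⊆ J := hR.ordConnected.uIcc_subset ht.1 hs.1
  have hKJ' : uIoc t s ⊆ J := uIoc_subset_uIcc.trans hKJ
  have i₁ := (intervalIntegrable_iff.1 (hg.intervalIntegrable_mul hR hf₁ ht.1 hs.1)).norm
  have i₂ := (intervalIntegrable_iff.1 (hg.intervalIntegrable_mul hR hf₂ ht.1 hs.1)).norm
  -- Green's formula: between two points the Wronskian with `fᵢ` changes by at most `‖z - e‖` times
  -- the integral of `‖g fᵢ‖`.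
  have step : ∀ r ∈ uIcc t s \ range x, N r ≤ N t + ‖z - e‖ *
      ∫ y in uIoc t s, (‖g y * f₁ y‖ + ‖g y * f₂ y‖) := by
    intro r hr
    have hrJ : r ∈ J \ range x := ⟨hKJ hr.1, hr.2⟩
    have hsub : uIoc t r ⊆ uIoc t s := fun y hy => by
      rcases mem_uIcc.1 hr.1 with h | h <;> rcases mem_uIoc.1 hy with h' | h' <;>
        rw [mem_uIoc] <;> first
        | exact Or.inl ⟨by linarith, by linarith⟩
        | exact Or.inr ⟨by linarith, by linarith⟩
    have aux : ∀ h, SolOn J Q x κ e h → IntegrableOn (fun y => ‖g y * h y‖) (uIoc t s) →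
        ‖wronskian g h r‖ ≤ ‖wronskian g h t‖ + ‖z - e‖ * ∫ y in uIoc t s, ‖g y * h y‖ := by
      intro h hh hi
      have h₁ := hg.wronskian_sub hR hh ht hrJ
      have h₂ : ‖wronskian g h r - wronskian g h t‖ ≤
          ‖z - e‖ * ∫ y in uIoc t s, ‖g y * h y‖ := by
        rw [h₁, norm_mul]
        gcongr
        refine intervalIntegral.norm_integral_le_integral_norm_uIoc.trans ?_
        exact setIntegral_mono_set hi (Eventually.of_forall fun y => norm_nonneg _)
          hsub.eventuallyLE
      linarith [norm_le_norm_add_norm_sub' (wronskian g h r) (wronskian g h t)]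
    have a₁ := aux f₁ hf₁ i₁
    have a₂ := aux f₂ hf₂ i₂
    rw [integral_add i₁ i₂]
    simp only [N, coeffNorm]
    linarith
  set S := N '' (uIcc t s \ range x)
  have hbdd : BddAbove S := ⟨_, by rintro _ ⟨r, hr, rfl⟩; exact step r hr⟩
  have hsS : N s ∈ S := ⟨s, ⟨right_mem_uIcc, hs.2⟩, rfl⟩
  -- Bounding `g` by `m / ‖w‖ * (‖f₁‖ + ‖f₂‖)` inside the integral closes the estimate: smallness
  -- gives `m ≤ N t + m / 2`, hence `m ≤ 2 N t`.
  set m := sSup S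
  have hm : ∀ r ∈ uIcc t s \ range x, N r ≤ m := fun r hr => le_csSup hbdd ⟨r, hr, rfl⟩
  have hm0 : 0 ≤ m := (hN s).trans (hm s ⟨right_mem_uIcc, hs.2⟩)
  have hint : ∫ y in uIoc t s, (‖g y * f₁ y‖ + ‖g y * f₂ y‖) ≤
      m / ‖w‖ * ∫ y in J, (‖f₁ y‖ + ‖f₂ y‖) ^ 2 := by
    calc ∫ y in uIoc t s, (‖g y * f₁ y‖ + ‖g y * f₂ y‖)
        ≤ ∫ y in uIoc t s, m / ‖w‖ * (‖f₁ y‖ + ‖f₂ y‖) ^ 2 := by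
          refine integral_mono_ae (i₁.add i₂) ((hF.mono_set hKJ').const_mul _) ?_
          filter_upwards [ae_restrict_mem measurableSet_uIoc,
            ae_notMem_range x _ Measure.restrict_le_self.absolutelyContinuous] with y hy hyx
          have h₁ := norm_mul_norm_le_coeffNorm (g := g) (hw y ⟨hKJ' hy, hyx⟩)
          have h₂ := hm y ⟨uIoc_subset_uIcc hy, hyx⟩
          have h₃ : ‖g y‖ ≤ m / ‖w‖ * (‖f₁ y‖ + ‖f₂ y‖) := by
            rw [div_mul_eq_mul_div, le_div_iff₀ hwpos, mul_comm]
            exact h₁.trans (by gcongr)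
          rw [norm_mul, norm_mul, ← mul_add, pow_two, ← mul_assoc]
          gcongr
      _ = m / ‖w‖ * ∫ y in uIoc t s, (‖f₁ y‖ + ‖f₂ y‖) ^ 2 := integral_const_mul _ _
      _ ≤ m / ‖w‖ * ∫ y in J, (‖f₁ y‖ + ‖f₂ y‖) ^ 2 := by
          refine mul_le_mul_of_nonneg_left ?_ (by positivity)
          exact setIntegral_mono_set hF (Eventually.of_forall fun y => by positivity)
            hKJ'.eventuallyLE
  have hm2 : m ≤ N t + m / 2 := by
    refine csSup_le ⟨_, hsS⟩ ?_
    rintro _ ⟨r, hr, rfl⟩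
    refine (step r hr).trans ?_
    have : ‖z - e‖ * ∫ y in uIoc t s, (‖g y * f₁ y‖ + ‖g y * f₂ y‖) ≤ m / 2 := by
      calc ‖z - e‖ * ∫ y in uIoc t s, (‖g y * f₁ y‖ + ‖g y * f₂ y‖)
          ≤ ‖z - e‖ * (m / ‖w‖ * ∫ y in J, (‖f₁ y‖ + ‖f₂ y‖) ^ 2) := by gcongr
        _ = m * (‖z - e‖ / ‖w‖ * ∫ y in J, (‖f₁ y‖ + ‖f₂ y‖) ^ 2) := by ring
        _ ≤ m * (1 / 2) := by gcongr
        _ = m / 2 := by ring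
    linarith
  have := hm s ⟨right_mem_uIcc, hs.2⟩
  linarith

theorem integrableOn_sq_of_memLp (h₁ : MemLp f₁ 2 (volume.restrict J))
    (h₂ : MemLp f₂ 2 (volume.restrict J)) :
    IntegrableOn (fun t => (‖f₁ t‖ + ‖f₂ t‖) ^ 2) J :=
  (h₁.norm.add h₂.norm).integrable_sq

/-- Square integrability of a fundamental system for one spectral parameter carries over to the
solutions for all other spectral parameters. -/
theorem memLp_of_small (hR : Regular J Q x κ) (hf₁ : SolOn J Q x κ e f₁)
    (hf₂ : SolOn J Q x κ e f₂) (hg : SolOn J Q x κ z g)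
    (hw : ∀ t ∈ J \ range x, wronskian f₁ f₂ t = w) (hw0 : w ≠ 0)
    (h₁ : MemLp f₁ 2 (volume.restrict J)) (h₂ : MemLp f₂ 2 (volume.restrict J))
    (hsmall : ‖z - e‖ / ‖w‖ * ∫ t in J, (‖f₁ t‖ + ‖f₂ t‖) ^ 2 ≤ 1 / 2)
    (ht : t ∈ J \ range x) : MemLp g 2 (volume.restrict J) := by
  have hwpos : 0 < ‖w‖ := norm_pos_iff.2 hw0
  refine MemLp.of_le_mul (c := 2 * coeffNorm g f₁ f₂ t / ‖w‖) (h₁.norm.add h₂.norm)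
    (hg.aestronglyMeasurable hR) ?_
  filter_upwards [ae_restrict_mem hR.isOpen.measurableSet,
    ae_notMem_range x _ Measure.restrict_le_self.absolutelyContinuous] with s hs hsx
  have k₁ := coeffNorm_le_two_mul hR hf₁ hf₂ hg hw hw0 (integrableOn_sq_of_memLp h₁ h₂) hsmall
    ⟨hs, hsx⟩ ht
  have k₂ := norm_mul_norm_le_coeffNorm (g := g) (hw s ⟨hs, hsx⟩)
  rw [Pi.add_apply, Real.norm_of_nonneg (by positivity), div_mul_eq_mul_div, le_div_iff₀ hwpos,
    mul_comm]
  exact k₂.trans (by gcongr)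

/-- A solution all of whose coefficients tend to zero vanishes. -/
theorem eq_zero_of_tendsto_wronskian (hR : Regular J Q x κ) (hf₁ : SolOn J Q x κ e f₁)
    (hf₂ : SolOn J Q x κ e f₂) (hg : SolOn J Q x κ z g)
    (hw : ∀ t ∈ J \ range x, wronskian f₁ f₂ t = w) (hw0 : w ≠ 0)
    (h₁ : MemLp f₁ 2 (volume.restrict J)) (h₂ : MemLp f₂ 2 (volume.restrict J))
    (hsmall : ‖z - e‖ / ‖w‖ * ∫ t in J, (‖f₁ t‖ + ‖f₂ t‖) ^ 2 ≤ 1 / 2)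
    {l : Filter ℝ} [l.NeBot] (hl : ∀ᶠ t in l, t ∈ J \ range x)
    (k₁ : Tendsto (wronskian g f₁) l (𝓝 0)) (k₂ : Tendsto (wronskian g f₂) l (𝓝 0))
    (hs : s ∈ J \ range x) : g s = 0 ∧ deriv g s = 0 := by
  have hN : Tendsto (fun t => 2 * coeffNorm g f₁ f₂ t) l (𝓝 0) := by
    have := (k₁.norm.add k₂.norm).const_mul 2
    simpa [coeffNorm] using this
  -- The factor two is uniform in `t`, so `t` may run to the end while `s` stays fixed.
  have hle : coeffNorm g f₁ f₂ s ≤ 0 := by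
    refine ge_of_tendsto hN ?_
    filter_upwards [hl] with t ht
    exact coeffNorm_le_two_mul hR hf₁ hf₂ hg hw hw0 (integrableOn_sq_of_memLp h₁ h₂) hsmall hs ht
  refine eq_zero_of_coeffNorm_eq_zero (by rw [hw s hs]; exact hw0) (le_antisymm hle ?_)
  simp only [coeffNorm]
  positivity

end PointInteraction

end

noncomputable section

namespace PointInteraction

variable {I : Set ℤ} {J N : Set ℝ} {Q : ℝ → ℝ} {x : I → ℝ} {κ κ' : Couplings I}
  {z e w : ℂ} {f f₁ f₂ g : ℝ → ℂ} {q s t : ℝ} {l m : Filter ℝ}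

/-! ### End points -/

/-- The properties of the filters of neighbourhoods of an end point of an interval. -/
structure IsEnd (l : Filter ℝ) : Prop where
  neBot : ∀ S : Set ℝ, S.Countable → (l ⊓ 𝓟 Sᶜ).NeBot
  exists_small : ∀ N ∈ l, ∀ k : ℝ → ℝ, IntegrableOn k N → ∀ ε > 0,
    ∃ N' ∈ l, N' ⊆ N ∧ IsOpen N' ∧ N'.OrdConnected ∧ ∫ t in N', k t ≤ ε

/-- The filter of right neighbourhoods of `a` in the reals. -/
def leftEnd (a : EReal) : Filter ℝ := comap (fun t : ℝ => (t : EReal)) (𝓝[>] a)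

/-- The filter of left neighbourhoods of `b` in the reals. -/
def rightEnd (b : EReal) : Filter ℝ := comap (fun t : ℝ => (t : EReal)) (𝓝[<] b)

theorem mem_leftEnd {a b : EReal} (hab : a < b) {S : Set ℝ} :
    S ∈ leftEnd a ↔ ∃ c : ℝ, c ∈ interval a b ∧ interval a c ⊆ S := by
  have hB := (nhdsGT_basis_of_exists_gt ⟨b, hab⟩).comap (fun t : ℝ => (t : EReal))
  constructor
  · intro h
    obtain ⟨u, hu, hS⟩ := hB.mem_iff.1 h
    obtain ⟨c, hc₁, hc₂⟩ := EReal.lt_iff_exists_real_btwn.1 (lt_min hu hab)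
    exact ⟨c, ⟨hc₁, hc₂.trans_le (min_le_right _ _)⟩,
      fun t ht => hS ⟨ht.1, (ht.2.trans hc₂).trans_le (min_le_left _ _)⟩⟩
  · rintro ⟨c, hc, hS⟩
    exact hB.mem_iff.2 ⟨c, hc.1, hS⟩

theorem mem_rightEnd {a b : EReal} (hab : a < b) {S : Set ℝ} :
    S ∈ rightEnd b ↔ ∃ c : ℝ, c ∈ interval a b ∧ interval c b ⊆ S := by
  have hB := (nhdsLT_basis_of_exists_lt ⟨a, hab⟩).comap (fun t : ℝ => (t : EReal))
  constructor
  · intro h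
    obtain ⟨u, hu, hS⟩ := hB.mem_iff.1 h
    obtain ⟨c, hc₁, hc₂⟩ := EReal.lt_iff_exists_real_btwn.1 (max_lt hu hab)
    exact ⟨c, ⟨(le_max_right _ _).trans_lt hc₁, hc₂⟩,
      fun t ht => hS ⟨((le_max_left _ _).trans_lt hc₁).trans ht.1, ht.2⟩⟩
  · rintro ⟨c, hc, hS⟩
    exact hB.mem_iff.2 ⟨c, hc.2, hS⟩

theorem nonempty_interval_diff {a b : EReal} (hab : a < b) {S : Set ℝ} (hS : S.Countable) :
    (interval a b \ S).Nonempty := by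
  obtain ⟨c, hc₁, hc₂⟩ := EReal.lt_iff_exists_real_btwn.1 hab
  obtain ⟨d, hd₁, hd₂⟩ := EReal.lt_iff_exists_real_btwn.1 hc₂
  have hcd : c < d := EReal.coe_lt_coe_iff.1 hd₁
  by_contra hne
  rw [not_nonempty_iff_eq_empty, sdiff_eq_empty] at hne
  have hI : Icc c d ⊆ interval a b := fun t ht =>
    ⟨hc₁.trans_le (EReal.coe_le_coe_iff.2 ht.1), (EReal.coe_le_coe_iff.2 ht.2).trans_lt hd₂⟩
  exact (Cardinal.Real.Icc_countable_iff.1 (hS.mono (hI.trans hne))).not_gt hcd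

/-- The integral over small sets of an antitone sequence with empty intersection is small. -/
theorem exists_setIntegral_le_of_antitone {S : ℕ → Set ℝ} (hS : ∀ n, MeasurableSet (S n))
    (ha : Antitone S) (he : ⋂ n, S n = ∅) {k : ℝ → ℝ} (hk : IntegrableOn k (S 0)) {ε : ℝ}
    (hε : 0 < ε) : ∃ n, ∫ t in S n, k t ≤ ε := by
  have h := tendsto_setIntegral_of_antitone hS ha ⟨0, hk⟩
  rw [he, Measure.restrict_empty, integral_zero_measure] at h
  exact ((h.eventually (gt_mem_nhds hε)).exists).imp fun n hn => le_of_lt hn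

/-- A countable set cannot contain an interval, so the end can be approached outside it. The
intervals `(a, u n)` decrease to the empty set, so integrals over them tend to zero. -/
theorem isEnd_leftEnd {a b : EReal} (hab : a < b) : IsEnd (leftEnd a) := by
  refine ⟨fun S hS => ?_, fun N hN k hk ε hε => ?_⟩
  · rw [← frequently_mem_iff_neBot, frequently_iff]
    intro U hU
    obtain ⟨c, hc, hcU⟩ := (mem_leftEnd hab).1 hU
    obtain ⟨t, ht⟩ := nonempty_interval_diff hc.1 hS
    exact ⟨t, hcU ht.1, ht.2⟩
  · obtain ⟨c, hc, hcN⟩ := (mem_leftEnd hab).1 hN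
    obtain ⟨u, hu, huc, hua⟩ := exists_seq_strictAnti_tendsto' hc.1
    have hsub : ∀ n, interval a (u n) ⊆ interval a c := fun n =>
      interval_subset_interval le_rfl (huc n).2.le
    obtain ⟨n, hn⟩ := exists_setIntegral_le_of_antitone (S := fun n => interval a (u n))
      (fun n => (isOpen_interval _ _).measurableSet)
      (fun i j hij => interval_subset_interval le_rfl (hu.antitone hij)) (by
        rw [eq_empty_iff_forall_notMem]
        intro t ht
        rw [mem_iInter] at ht
        exact (ge_of_tendsto' hua fun n => (ht n).2.le).not_gt (ht 0).1)
      (hk.mono_set ((hsub 0).trans hcN)) hε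
    refine ⟨interval a (u n), ?_, (hsub n).trans hcN, isOpen_interval _ _,
      ordConnected_interval _ _, hn⟩
    obtain ⟨d, hd₁, hd₂⟩ := EReal.lt_iff_exists_real_btwn.1 (huc n).1
    exact (mem_leftEnd hab).2 ⟨d, ⟨hd₁, (hd₂.trans (huc n).2).trans hc.2⟩,
      interval_subset_interval le_rfl hd₂.le⟩

theorem isEnd_rightEnd {a b : EReal} (hab : a < b) : IsEnd (rightEnd b) := by
  refine ⟨fun S hS => ?_, fun N hN k hk ε hε => ?_⟩
  · rw [← frequently_mem_iff_neBot, frequently_iff]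
    intro U hU
    obtain ⟨c, hc, hcU⟩ := (mem_rightEnd hab).1 hU
    obtain ⟨t, ht⟩ := nonempty_interval_diff hc.2 hS
    exact ⟨t, hcU ht.1, ht.2⟩
  · obtain ⟨c, hc, hcN⟩ := (mem_rightEnd hab).1 hN
    obtain ⟨u, hu, huc, hua⟩ := exists_seq_strictMono_tendsto' hc.2
    have hsub : ∀ n, interval (u n) b ⊆ interval c b := fun n =>
      interval_subset_interval (huc n).1.le le_rfl
    obtain ⟨n, hn⟩ := exists_setIntegral_le_of_antitone (S := fun n => interval (u n) b)
      (fun n => (isOpen_interval _ _).measurableSet)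
      (fun i j hij => interval_subset_interval (hu.monotone hij) le_rfl) (by
        rw [eq_empty_iff_forall_notMem]
        intro t ht
        rw [mem_iInter] at ht
        exact (le_of_tendsto' hua fun n => (ht n).1.le).not_gt (ht 0).2)
      (hk.mono_set ((hsub 0).trans hcN)) hε
    refine ⟨interval (u n) b, ?_, (hsub n).trans hcN, isOpen_interval _ _,
      ordConnected_interval _ _, hn⟩
    obtain ⟨d, hd₁, hd₂⟩ := EReal.lt_iff_exists_real_btwn.1 (huc n).2
    exact (mem_rightEnd hab).2 ⟨d, ⟨(hc.1.trans (huc n).1).trans hd₁, hd₂⟩,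
      interval_subset_interval hd₁.le le_rfl⟩

/-- `f` is square integrable near the end `l`. -/
def LiesAt (l : Filter ℝ) (f : ℝ → ℂ) : Prop := ∃ N ∈ l, MemLp f 2 (volume.restrict N)

theorem liesLeft_iff {a b : EReal} (hab : a < b) : LiesLeft a b f ↔ LiesAt (leftEnd a) f := by
  constructor
  · rintro ⟨c, hc, h⟩
    exact ⟨_, (mem_leftEnd hab).2 ⟨c, hc, Subset.rfl⟩, h⟩
  · rintro ⟨N, hN, h⟩
    obtain ⟨c, hc, hcN⟩ := (mem_leftEnd hab).1 hN
    exact ⟨c, hc, h.mono_measure (Measure.restrict_mono_set _ hcN)⟩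

theorem liesRight_iff {a b : EReal} (hab : a < b) : LiesRight a b f ↔ LiesAt (rightEnd b) f := by
  constructor
  · rintro ⟨c, hc, h⟩
    exact ⟨_, (mem_rightEnd hab).2 ⟨c, hc, Subset.rfl⟩, h⟩
  · rintro ⟨N, hN, h⟩
    obtain ⟨c, hc, hcN⟩ := (mem_rightEnd hab).1 hN
    exact ⟨c, hc, h.mono_measure (Measure.restrict_mono_set _ hcN)⟩

/-- The limit circle property at an end only depends on the couplings near that end. -/
theorem liesAt_of_couplings_eq {J₀ : Set ℝ} (hR : Regular J₀ Q x κ)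
    (hJ : IsOpen J) (hJo : J.OrdConnected) (hJJ₀ : J ⊆ J₀) (hJl : J ∈ l) (hl : IsEnd l)
    (hκ : ∀ n, x n ∈ J → κ'.matrix n = κ.matrix n)
    (h : ∀ f, SolOn J₀ Q x κ z f → LiesAt l f) (hg : SolOn J₀ Q x κ' z g) : LiesAt l g := by
  obtain ⟨u₁, u₂, hu₁, hu₂, hw⟩ := hR.hasFundamentalSystem z
  obtain ⟨N₁, hN₁, k₁⟩ := h u₁ hu₁
  obtain ⟨N₂, hN₂, k₂⟩ := h u₂ hu₂
  have hRJ := hR.mono hJ hJo hJJ₀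
  -- Near the end the couplings coincide, so `g` solves the original equation there and is a
  -- combination of `u₁` and `u₂`.
  have hgJ : SolOn J Q x κ z g := (hg.mono hJJ₀).congr_couplings hκ
  have v₁ := hu₁.mono hJJ₀
  have v₂ := hu₂.mono hJJ₀
  have := hl.neBot (range x) (countable_range x)
  obtain ⟨s, hs⟩ := (l ⊓ 𝓟 (range x)ᶜ).nonempty_of_mem (inter_mem_inf hJl (mem_principal_self _))
  have hs' : s ∈ J \ range x := hs
  refine ⟨(N₁ ∩ N₂) ∩ J, inter_mem (inter_mem hN₁ hN₂) hJl, ?_⟩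
  have m₁ := k₁.mono_measure (Measure.restrict_mono_set volume
    (show N₁ ∩ N₂ ∩ J ⊆ N₁ from fun t ht => ht.1.1))
  have m₂ := k₂.mono_measure (Measure.restrict_mono_set volume
    (show N₁ ∩ N₂ ∩ J ⊆ N₂ from fun t ht => ht.1.2))
  refine ((m₁.const_mul (wronskian g u₂ s / wronskian u₁ u₂ s)).sub
    (m₂.const_mul (wronskian g u₁ s / wronskian u₁ u₂ s))).ae_eq ?_
  have hJae : ∀ᵐ t ∂(volume.restrict (N₁ ∩ N₂ ∩ J)), t ∈ J :=
    ae_mono (Measure.restrict_mono_set _ inter_subset_right) (ae_restrict_mem hJ.measurableSet)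
  filter_upwards [hJae, ae_notMem_range x _ Measure.restrict_le_self.absolutelyContinuous]
    with t ht htx
  have e₁ := wronskian_mul_eq g u₁ u₂ t
  rw [v₁.wronskian_eq hRJ v₂ hs' ⟨ht, htx⟩, hgJ.wronskian_eq hRJ v₂ hs' ⟨ht, htx⟩,
    hgJ.wronskian_eq hRJ v₁ hs' ⟨ht, htx⟩] at e₁
  have hws := hw s ⟨hJJ₀ hs'.1, hs'.2⟩
  simp only [Pi.sub_apply]
  field_simp
  linear_combination -e₁

/-! ### Boundary conditions -/

theorem deriv_conj (f : ℝ → ℂ) (t : ℝ) :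
    deriv (fun t => starRingEnd ℂ (f t)) t = starRingEnd ℂ (deriv f t) :=
  deriv.star (f := f)

theorem conj_deriv_ofReal (v : ℝ → ℝ) (t : ℝ) :
    starRingEnd ℂ (deriv (fun t => (v t : ℂ)) t) = deriv (fun t => (v t : ℂ)) t := by
  rw [← deriv_conj]
  simp

theorem rightLim_eq_of_continuousAt {f : ℝ → ℂ} (h : ContinuousAt f t) :
    Function.rightLim f t = f t :=
  rightLim_eq_of_tendsto (h.mono_left nhdsWithin_le_nhds)

theorem lagrangeBracket_eq_wronskian (hR : Regular N Q x κ) {v : ℝ → ℝ}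
    (hv : SolOn N Q x κ z (fun t => (v t : ℂ))) (hf : SolOn N Q x κ e f) (ht : t ∈ N \ range x) :
    lagrangeBracket (fun t => (v t : ℂ)) f t = wronskian (fun t => (v t : ℂ)) f t := by
  rw [lagrangeBracket, rightLim_eq_of_continuousAt (hv.continuousAt ht),
    rightLim_eq_of_continuousAt (hf.continuousAt ht),
    rightLim_eq_of_continuousAt (hv.continuousAt_deriv hR ht),
    rightLim_eq_of_continuousAt (hf.continuousAt_deriv hR ht), conj_deriv_ofReal]
  simp [wronskian]

/-- Since `v` is real, conjugation leaves its one-sided limits unchanged. This covers interaction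
points, where the bracket is defined by limits from the right. -/
theorem tendsto_wronskian_lagrangeBracket (hR : Regular N Q x κ) {v : ℝ → ℝ}
    (hv : SolOn N Q x κ z (fun t => (v t : ℂ))) (hf : SolOn N Q x κ e f) (ht : t ∈ N) :
    Tendsto (wronskian (fun t => (v t : ℂ)) f) (𝓝[>] t)
      (𝓝 (lagrangeBracket (fun t => (v t : ℂ)) f t)) := by
  obtain ⟨a₀, a₁, h₁, h₂⟩ := hv.exists_tendsto_right hR ht
  obtain ⟨b₀, b₁, h₃, h₄⟩ := hf.exists_tendsto_right hR ht
  have hc := Complex.continuous_conj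
  have c₀ : starRingEnd ℂ a₀ = a₀ := by
    refine tendsto_nhds_unique ((hc.tendsto a₀).comp h₁) (h₁.congr fun t => ?_)
    simp
  have c₁ : starRingEnd ℂ a₁ = a₁ := by
    refine tendsto_nhds_unique ((hc.tendsto a₁).comp h₂) (h₂.congr fun t => ?_)
    simp [conj_deriv_ofReal]
  rw [lagrangeBracket, rightLim_eq_of_tendsto h₁, rightLim_eq_of_tendsto h₂,
    rightLim_eq_of_tendsto h₃, rightLim_eq_of_tendsto h₄, c₀, c₁]
  exact (h₁.mul h₄).sub (h₂.mul h₃)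

/-- In the boundary condition, the bracket can be evaluated away from the interaction points. -/
theorem tendsto_lagrangeBracket_iff (hl : IsEnd l) (hR : Regular N Q x κ) (hN : N ∈ l) {v : ℝ → ℝ}
    (hv : SolOn N Q x κ z (fun t => (v t : ℂ))) (hf : SolOn N Q x κ e f) :
    Tendsto (lagrangeBracket (fun t => (v t : ℂ)) f) l (𝓝 0) ↔
      Tendsto (wronskian (fun t => (v t : ℂ)) f) (l ⊓ 𝓟 (range x)ᶜ) (𝓝 0) := by
  constructor
  · intro h
    refine (h.mono_left inf_le_left).congr' ?_
    filter_upwards [inter_mem_inf hN (mem_principal_self _)] with t ht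
    exact lagrangeBracket_eq_wronskian hR hv hf ht
  · intro h
    rw [Metric.tendsto_nhds] at h ⊢
    intro ε hε
    have h' := h (ε / 2) (by positivity)
    rw [eventually_inf_principal] at h'
    -- The integrand `0` is a dummy: only the openness of `N'` is wanted, so that right neighbours
    -- of `t` remain in `N'`. The bracket at `t` is then a limit of values below `ε / 2`.
    obtain ⟨N', hN', hsub, hopen, -, -⟩ := hl.exists_small _ (inter_mem h' hN) (fun _ => 0)
      integrableOn_zero 1 one_pos
    filter_upwards [hN'] with t ht
    have hlim := tendsto_wronskian_lagrangeBracket hR hv hf (hsub ht).2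
    have hle : dist (lagrangeBracket (fun t => (v t : ℂ)) f t) 0 ≤ ε / 2 := by
      refine le_of_tendsto (hlim.dist tendsto_const_nhds) ?_
      filter_upwards [nhdsWithin_le_nhds (hopen.mem_nhds ht),
        (hR.discrete t (hsub ht).2).filter_mono
          (nhdsWithin_mono t fun r (hr : t < r) => hr.ne')] with r hr hrx
      exact ((hsub hr).1 hrx).le
    linarith

/-- The boundary values along `m` of the square integrable solutions on `J` that satisfy the
boundary condition along `l` in case `P` holds. -/
def boundaryValues (J : Set ℝ) (l m : Filter ℝ) (Q : ℝ → ℝ) (x : I → ℝ) (κ : Couplings I) (e : ℂ)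
    (v : ℝ → ℝ) (P : Prop) : Set (ℂ × ℂ) :=
  {y | ∃ f, SolOn J Q x κ e f ∧ MemLp f 2 (volume.restrict J) ∧
    (P → Tendsto (wronskian (fun t => (v t : ℂ)) f) (l ⊓ 𝓟 (range x)ᶜ) (𝓝 0)) ∧
    Tendsto f m (𝓝 y.1) ∧ Tendsto (deriv f) m (𝓝 y.2)}

theorem boundaryValues_smul {v : ℝ → ℝ} {P : Prop} (hR : Regular J Q x κ) {y : ℂ × ℂ}
    (hJ : J ∈ l) (hm : J \ range x ∈ m)
    (hy : y ∈ boundaryValues J l m Q x κ e v P) (c : ℂ) :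
    c • y ∈ boundaryValues J l m Q x κ e v P := by
  obtain ⟨f, h₁, h₂, h₃, h₄, h₅⟩ := hy
  have hd : ∀ t ∈ J \ range x,
      deriv (fun t => c * f t + 0 * f t) t = c * deriv f t := fun t ht => by
    rw [h₁.deriv_linearCombination h₁ c 0 ht]
    ring
  -- The multiple `c f` is written as `c f + 0 f` to reuse linearity.
  refine ⟨_, h₁.linearCombination hR h₁ c 0, ?_, fun hP => ?_, ?_, ?_⟩
  · simpa using h₂.const_mul c
  · have := (h₃ hP).const_mul c
    rw [mul_zero] at this
    refine this.congr' ?_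
    filter_upwards [inter_mem_inf hJ (mem_principal_self _)] with t ht
    rw [wronskian, wronskian, hd t ht]
    ring
  · simpa using h₄.const_mul c
  · refine (h₅.const_mul c).congr' ?_
    filter_upwards [hm] with t ht using (hd t ht).symm

/-- `Q`, `E` and the interaction matrices are real. -/
theorem SolOn.conj {E : ℝ} (hf : SolOn J Q x κ E f) :
    SolOn J Q x κ E (fun t => starRingEnd ℂ (f t)) := by
  intro q hq
  have hc := Complex.continuous_conj
  have hde : deriv (fun t => starRingEnd ℂ (f t)) = fun t => starRingEnd ℂ (deriv f t) :=
    funext (deriv_conj f)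
  refine ⟨fun hqx => ?_, fun n hn => ?_⟩
  · obtain ⟨h₁, h₂⟩ := (hf q hq).1 hqx
    refine ⟨h₁.hasDerivAt.star.differentiableAt, ?_⟩
    rw [hde]
    refine (h₂.star.congr_deriv ?_).congr_of_eventuallyEq (Eventually.of_forall fun t => ?_)
    · simp
    · simp
  · obtain ⟨l₀, l₁, h₁, h₂, h₃, h₄⟩ := jumpCondition_iff.1 ((hf q hq).2 n hn)
    refine jumpCondition_iff.2 ⟨starRingEnd ℂ l₀, starRingEnd ℂ l₁, (hc.tendsto _).comp h₁, ?_,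
      ?_, ?_⟩
    · rw [hde]
      exact (hc.tendsto _).comp h₂
    · simpa [Function.comp_def] using (hc.tendsto _).comp h₃
    · rw [hde]
      simpa [Function.comp_def] using (hc.tendsto _).comp h₄

/-- The boundary condition is real as well, because `v` is. With dimension at most one, this makes
the boundary values multiples of a real vector. -/
theorem boundaryValues_conj {v : ℝ → ℝ} {P : Prop} {E : ℝ} {y : ℂ × ℂ}
    (hy : y ∈ boundaryValues J l m Q x κ (E : ℂ) v P) :
    (starRingEnd ℂ y.1, starRingEnd ℂ y.2) ∈ boundaryValues J l m Q x κ (E : ℂ) v P := by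
  obtain ⟨f, h₁, h₂, h₃, h₄, h₅⟩ := hy
  have hc := Complex.continuous_conj
  refine ⟨_, h₁.conj, ?_, fun hP => ?_, (hc.tendsto _).comp h₄, ?_⟩
  · exact h₂.star
  · have := (hc.tendsto 0).comp (h₃ hP)
    rw [map_zero] at this
    refine this.congr fun t => ?_
    simp only [Function.comp_apply, wronskian, deriv_conj, map_sub, map_mul, conj_deriv_ofReal,
      Complex.conj_ofReal]
  · have := (hc.tendsto _).comp h₅
    exact this.congr fun t => (deriv_conj f t).symm

/-- The boundary values form a space of dimension at most one. -/
theorem boundaryValues_det_eq_zero {v : ℝ → ℝ} {P : Prop} {y y' : ℂ × ℂ} {lam : ℂ}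
    (hl : IsEnd l) (hR : Regular J Q x κ) (hJ : J ∈ l) [m.NeBot] (hm : J \ range x ∈ m)
    (hP : ¬ P → ∃ z g, SolOn J Q x κ z g ∧ ¬ LiesAt l g)
    (hN : N ∈ l) (hNJ : N ⊆ J) (hv : SolOn N Q x κ lam (fun t => (v t : ℂ)))
    (hv0 : ∀ t ∈ N \ range x, ¬ (v t = 0 ∧ deriv (fun t => (v t : ℂ)) t = 0))
    (hy : y ∈ boundaryValues J l m Q x κ e v P) (hy' : y' ∈ boundaryValues J l m Q x κ e v P) :
    y.1 * y'.2 - y.2 * y'.1 = 0 := by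
  obtain ⟨f₁, h₁, h₂, h₃, h₄, h₅⟩ := hy
  obtain ⟨f₂, k₁, k₂, k₃, k₄, k₅⟩ := hy'
  obtain ⟨r, hr⟩ := m.nonempty_of_mem hm
  set w := wronskian f₁ f₂ r
  have hw : ∀ t ∈ J \ range x, wronskian f₁ f₂ t = w := fun t ht => h₁.wronskian_eq hR k₁ hr ht
  have hlim : y.1 * y'.2 - y.2 * y'.1 = w := by
    refine tendsto_nhds_unique ((h₄.mul k₅).sub (h₅.mul k₄)) (tendsto_const_nhds.congr' ?_)
    filter_upwards [hm] with t ht using (hw t ht).symm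
  rw [hlim]
  by_contra hw0
  have hF := integrableOn_sq_of_memLp h₂ k₂
  have := hl.neBot (range x) (countable_range x)
  have small : ∀ z : ℂ, ∀ U ∈ l, U ⊆ J → ∃ N' ∈ l, N' ⊆ U ∧ Regular N' Q x κ ∧
      ‖z - e‖ / ‖w‖ * ∫ t in N', (‖f₁ t‖ + ‖f₂ t‖) ^ 2 ≤ 1 / 2 := by
    intro z U hU hUJ
    set C := ‖z - e‖ / ‖w‖
    have hC : 0 ≤ C := by positivity
    -- With `C + 1` in place of `C` the bound also makes sense when `C = 0`, that is, when `z = e`.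
    obtain ⟨N', hN', hsub, ho, hoc, hle⟩ := hl.exists_small U hU _ (hF.mono_set hUJ)
      (1 / (2 * (C + 1))) (by positivity)
    refine ⟨N', hN', hsub, hR.mono ho hoc (hsub.trans hUJ), ?_⟩
    calc C * ∫ t in N', (‖f₁ t‖ + ‖f₂ t‖) ^ 2 ≤ C * (1 / (2 * (C + 1))) := by gcongr
      _ ≤ 1 / 2 := by
        rw [mul_one_div, div_le_div_iff₀ (by positivity) two_pos]
        linarith
  have mono : ∀ {f : ℝ → ℂ} {N' : Set ℝ}, MemLp f 2 (volume.restrict J) → N' ⊆ J →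
      MemLp f 2 (volume.restrict N') := fun hf h => hf.mono_measure (Measure.restrict_mono_set _ h)
  have exists_pt : ∀ U ∈ l, ∃ s, s ∈ U \ range x := fun U hU =>
    (l ⊓ 𝓟 (range x)ᶜ).nonempty_of_mem (inter_mem_inf hU (mem_principal_self _))
  by_cases hPP : P
  -- Here `v`, a solution for `lam`, plays the role of `g`: both of its coefficients tend to zero,
  -- contradicting non-triviality.
  · obtain ⟨N', hN', hsub, hR', hsmall⟩ := small lam N hN hNJ
    have hN'J := hsub.trans hNJ
    obtain ⟨s, hs⟩ := exists_pt N' hN'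
    have := eq_zero_of_tendsto_wronskian hR' (h₁.mono hN'J) (k₁.mono hN'J) (hv.mono hsub)
      (fun t ht => hw t ⟨hN'J ht.1, ht.2⟩) hw0 (mono h₂ hN'J) (mono k₂ hN'J) hsmall
      (inter_mem_inf hN' (mem_principal_self _) : N' \ range x ∈ l ⊓ 𝓟 (range x)ᶜ)
      (h₃ hPP) (k₃ hPP) hs
    exact hv0 s ⟨hsub hs.1, hs.2⟩ ⟨by exact_mod_cast this.1, this.2⟩
  -- The parameter `z` may differ from `e`, which is why variation of constants is needed to make
  -- `g` square integrable.
  · obtain ⟨z, g, hg, hgl⟩ := hP hPP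
    obtain ⟨N', hN', hsub, hR', hsmall⟩ := small z J hJ Subset.rfl
    obtain ⟨s, hs⟩ := exists_pt N' hN'
    exact hgl ⟨N', hN', memLp_of_small hR' (h₁.mono hsub) (k₁.mono hsub) (hg.mono hsub)
      (fun t ht => hw t ⟨hsub ht.1, ht.2⟩) hw0 (mono h₂ hsub) (mono k₂ hsub) hsmall hs⟩

end PointInteraction

end

noncomputable section

namespace PointInteraction

variable {I : Set ℤ} {J N : Set ℝ} {Q : ℝ → ℝ} {x : I → ℝ} {κ κ' : Couplings I}
  {z e : ℂ} {f : ℝ → ℂ} {a b : EReal} {V : ℝ → ℝ} {c p : ℝ}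

/-! ### Characterization of the eigenvalues by boundary values -/

/-- The action of a real matrix on `ℂ × ℂ`. -/
def mulPair (A : Matrix (Fin 2) (Fin 2) ℝ) (y : ℂ × ℂ) : ℂ × ℂ :=
  (A 0 0 * y.1 + A 0 1 * y.2, A 1 0 * y.1 + A 1 1 * y.2)

theorem matrix_replaceAt_of_ne {n n₀ : I} (h : n ≠ n₀) (α r θ : ℝ) :
    (κ.replaceAt n₀ α r θ).matrix n = κ.matrix n := by
  simp [Couplings.matrix, Couplings.replaceAt, h]

theorem matrix_replaceAt_self (n₀ : I) (α r θ : ℝ) :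
    (κ.replaceAt n₀ α r θ).matrix n₀ = interactionMatrix α r θ := by
  simp [Couplings.matrix, Couplings.replaceAt]

theorem r_replaceAt_pos {n₀ : I} {α r θ : ℝ} (hr : ∀ n, 0 < κ.r n) (hr₀ : 0 < r) (n : I) :
    0 < (κ.replaceAt n₀ α r θ).r n := by
  by_cases h : n = n₀
  · subst h; simpa [Couplings.replaceAt] using hr₀
  · simpa [Couplings.replaceAt, h] using hr n

theorem isSolution_iff_solOn {a' b' : EReal} (hV : LocallyIntegrableOn V (interval a b))
    (hp : p ∈ interval a b) (hsub : interval a' b' ⊆ interval a b)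
    (hR : Regular (interval a b) (primitive V p) x κ) :
    IsSolution a' b' V x κ z f ↔ SolOn (interval a' b') (primitive V p) x κ z f :=
  have hR' := hR.mono (isOpen_interval _ _) (ordConnected_interval _ _) hsub
  ⟨fun h => h.solOn hV hp hsub hR', fun h => h.isSolution hV hp hsub hR'⟩

theorem limitCircleLeft_iff (hab : a < b) (hV : LocallyIntegrableOn V (interval a b))
    (hp : p ∈ interval a b) (hR : Regular (interval a b) (primitive V p) x κ) :
    LimitCircleLeft a b V x κ ↔ ∀ z f, SolOn (interval a b) (primitive V p) x κ z f →
      LiesAt (leftEnd a) f := by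
  simp only [LimitCircleLeft, isSolution_iff_solOn hV hp Subset.rfl hR, liesLeft_iff hab]

theorem limitCircleRight_iff (hab : a < b) (hV : LocallyIntegrableOn V (interval a b))
    (hp : p ∈ interval a b) (hR : Regular (interval a b) (primitive V p) x κ) :
    LimitCircleRight a b V x κ ↔ ∀ z f, SolOn (interval a b) (primitive V p) x κ z f →
      LiesAt (rightEnd b) f := by
  simp only [LimitCircleRight, isSolution_iff_solOn hV hp Subset.rfl hR, liesRight_iff hab]

theorem interval_left_mem (hp : p ∈ interval a b) : interval a p ∈ leftEnd a :=
  (mem_leftEnd (hp.1.trans hp.2)).2 ⟨p, hp, Subset.rfl⟩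

theorem interval_right_mem (hp : p ∈ interval a b) : interval p b ∈ rightEnd b :=
  (mem_rightEnd (hp.1.trans hp.2)).2 ⟨p, hp, Subset.rfl⟩

/-- Only couplings on `(a, p)` matter at the end `a`, so varying the interaction at `p` never
switches the boundary condition on or off. -/
theorem LimitCircleLeft.congr (hV : LocallyIntegrableOn V (interval a b))
    (hp : p ∈ interval a b) (hR : Regular (interval a b) (primitive V p) x κ)
    (hR' : Regular (interval a b) (primitive V p) x κ')
    (hκ : ∀ n, x n ≠ p → κ'.matrix n = κ.matrix n) (h : LimitCircleLeft a b V x κ) :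
    LimitCircleLeft a b V x κ' := by
  have hab := hp.1.trans hp.2
  rw [limitCircleLeft_iff hab hV hp hR] at h
  rw [limitCircleLeft_iff hab hV hp hR']
  exact fun z f hf => liesAt_of_couplings_eq hR (isOpen_interval a p) (ordConnected_interval a p)
    (interval_subset_interval le_rfl hp.2.le) (interval_left_mem hp) (isEnd_leftEnd hab)
    (fun n hn => hκ n fun h => hn.2.ne (by rw [h])) (h z) hf

theorem LimitCircleRight.congr (hV : LocallyIntegrableOn V (interval a b))
    (hp : p ∈ interval a b) (hR : Regular (interval a b) (primitive V p) x κ)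
    (hR' : Regular (interval a b) (primitive V p) x κ')
    (hκ : ∀ n, x n ≠ p → κ'.matrix n = κ.matrix n) (h : LimitCircleRight a b V x κ) :
    LimitCircleRight a b V x κ' := by
  have hab := hp.1.trans hp.2
  rw [limitCircleRight_iff hab hV hp hR] at h
  rw [limitCircleRight_iff hab hV hp hR']
  exact fun z f hf => liesAt_of_couplings_eq hR (isOpen_interval p b) (ordConnected_interval p b)
    (interval_subset_interval hp.1.le le_rfl) (interval_right_mem hp) (isEnd_rightEnd hab)
    (fun n hn => hκ n fun h => hn.1.ne (by rw [h])) (h z) hf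

/-- A non-trivial solution and its derivative have no common zero. -/
theorem SolOn.not_eq_zero_and_deriv_eq_zero (hR : Regular J Q x κ) (hf : SolOn J Q x κ z f)
    (hne : ∃ t ∈ J \ range x, f t ≠ 0) {t : ℝ} (ht : t ∈ J \ range x) :
    ¬ (f t = 0 ∧ deriv f t = 0) := by
  rintro ⟨h₀, h₁⟩
  obtain ⟨s, hs, hfs⟩ := hne
  refine hfs ?_
  -- The zero solution enters as `0 f + 0 f`, with the same data as `f` at `t`.
  have h := (hR.hasFundamentalSystem z).eqOn hR hf (hf.linearCombination hR hf 0 0) ht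
    (by simp [h₀]) (by rw [hf.deriv_linearCombination hf 0 0 ht, h₁]; simp) hs
  simpa using h

theorem IsRealSolutionNearLeft.exists_nhds {v : ℝ → ℝ} {lam : ℝ}
    (hV : LocallyIntegrableOn V (interval a b)) (hp : p ∈ interval a b)
    (hR : Regular (interval a b) (primitive V p) x κ)
    (hv : IsRealSolutionNearLeft a b V x κ lam v) :
    ∃ N ∈ leftEnd a, N ⊆ interval a p ∧ Regular N (primitive V p) x κ ∧
      SolOn N (primitive V p) x κ lam (fun t => (v t : ℂ)) ∧
      ∀ t ∈ N \ range x, ¬ (v t = 0 ∧ deriv (fun t => (v t : ℂ)) t = 0) := by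
  obtain ⟨c, hc, hs, hne⟩ := hv
  have hsub : interval a c ⊆ interval a b := interval_subset_interval le_rfl hc.2.le
  have hRc := hR.mono (isOpen_interval a c) (ordConnected_interval a c) hsub
  rw [isSolution_iff_solOn hV hp hsub hR] at hs
  refine ⟨interval a c ∩ interval a p, inter_mem (interval_left_mem hc) (interval_left_mem hp),
    inter_subset_right, hRc.mono ((isOpen_interval _ _).inter (isOpen_interval _ _))
    ((ordConnected_interval _ _).inter (ordConnected_interval _ _)) inter_subset_left,
    hs.mono inter_subset_left, fun t ht h => ?_⟩
  refine hs.not_eq_zero_and_deriv_eq_zero hRc ?_ ⟨ht.1.1, ht.2⟩ ⟨by simp [h.1], h.2⟩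
  obtain ⟨t, ht, htv⟩ := hne
  exact ⟨t, ht, by simpa using htv⟩

theorem IsRealSolutionNearRight.exists_nhds {v : ℝ → ℝ} {lam : ℝ}
    (hV : LocallyIntegrableOn V (interval a b)) (hp : p ∈ interval a b)
    (hR : Regular (interval a b) (primitive V p) x κ)
    (hv : IsRealSolutionNearRight a b V x κ lam v) :
    ∃ N ∈ rightEnd b, N ⊆ interval p b ∧ Regular N (primitive V p) x κ ∧
      SolOn N (primitive V p) x κ lam (fun t => (v t : ℂ)) ∧
      ∀ t ∈ N \ range x, ¬ (v t = 0 ∧ deriv (fun t => (v t : ℂ)) t = 0) := by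
  obtain ⟨c, hc, hs, hne⟩ := hv
  have hsub : interval c b ⊆ interval a b := interval_subset_interval hc.1.le le_rfl
  have hRc := hR.mono (isOpen_interval c b) (ordConnected_interval c b) hsub
  rw [isSolution_iff_solOn hV hp hsub hR] at hs
  refine ⟨interval c b ∩ interval p b, inter_mem (interval_right_mem hc) (interval_right_mem hp),
    inter_subset_right, hRc.mono ((isOpen_interval _ _).inter (isOpen_interval _ _))
    ((ordConnected_interval _ _).inter (ordConnected_interval _ _)) inter_subset_left,
    hs.mono inter_subset_left, fun t ht h => ?_⟩
  refine hs.not_eq_zero_and_deriv_eq_zero hRc ?_ ⟨ht.1.1, ht.2⟩ ⟨by simp [h.1], h.2⟩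
  obtain ⟨t, ht, htv⟩ := hne
  exact ⟨t, ht, by simpa using htv⟩

/-- A solution with vanishing left-hand limits at one point vanishes. -/
theorem SolOn.eqOn_zero_of_tendsto_zero (hR : Regular J Q x κ) (hf : SolOn J Q x κ z f)
    (hp : p ∈ J) (h₀ : Tendsto f (𝓝[<] p) (𝓝 0)) (h₁ : Tendsto (deriv f) (𝓝[<] p) (𝓝 0)) :
    EqOn f 0 (J \ range x) := by
  obtain ⟨u₁, u₂, hu₁, hu₂, hw⟩ := hR.hasFundamentalSystem z
  have hev : ∀ᶠ t in 𝓝[<] p, t ∈ J \ range x := (hR.eventually_diff hp).filter_mono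
    (nhdsWithin_mono p fun t (ht : t < p) => ht.ne)
  have key : ∀ u, SolOn J Q x κ z u → ∀ t ∈ J \ range x, wronskian f u t = 0 := by
    intro u hu t ht
    obtain ⟨l₀, l₁, k₀, k₁⟩ := hu.exists_tendsto_left hR hp
    have hlim : Tendsto (wronskian f u) (𝓝[<] p) (𝓝 (0 * l₁ - 0 * l₀)) :=
      (h₀.mul k₁).sub (h₁.mul k₀)
    have hconst : Tendsto (wronskian f u) (𝓝[<] p) (𝓝 (wronskian f u t)) := by
      refine tendsto_const_nhds.congr' ?_
      filter_upwards [hev] with s hs using hf.wronskian_eq hR hu hs ht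
    simpa using tendsto_nhds_unique hconst hlim
  intro t ht
  have h := wronskian_mul_eq f u₁ u₂ t
  rw [key u₁ hu₁ t ht, key u₂ hu₂ t ht, zero_mul, zero_mul, sub_zero] at h
  exact (mul_eq_zero.1 h).resolve_left (hw t ht)

/-- Solutions on both sides of an interaction point whose boundary values are related by the
interaction matrix combine to a solution. -/
theorem SolOn.glue (hR : Regular (interval a b) Q x κ) {n₀ : I} (hp : x n₀ ∈ interval a b)
    {f g : ℝ → ℂ} {y : ℂ × ℂ} (hf : SolOn (interval a (x n₀)) Q x κ z f)
    (hg : SolOn (interval (x n₀) b) Q x κ z g)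
    (h₁ : Tendsto f (𝓝[<] (x n₀)) (𝓝 y.1)) (h₂ : Tendsto (deriv f) (𝓝[<] (x n₀)) (𝓝 y.2))
    (h₃ : Tendsto g (𝓝[>] (x n₀)) (𝓝 (mulPair (κ.matrix n₀) y).1))
    (h₄ : Tendsto (deriv g) (𝓝[>] (x n₀)) (𝓝 (mulPair (κ.matrix n₀) y).2)) :
    SolOn (interval a b) Q x κ z ((Iio (x n₀)).piecewise f g) := by
  set F := (Iio (x n₀)).piecewise f g
  have hl : ∀ t < x n₀, f =ᶠ[𝓝 t] F := fun t ht => by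
    filter_upwards [Iio_mem_nhds ht] with r hr
    exact (piecewise_eq_of_mem _ _ _ hr).symm
  have hr : ∀ t > x n₀, g =ᶠ[𝓝 t] F := fun t ht => by
    filter_upwards [Ioi_mem_nhds ht] with r hr
    exact (piecewise_eq_of_notMem (Iio (x n₀)) f g (notMem_Iio.2 (mem_Ioi.1 hr).le)).symm
  intro q hq
  rcases lt_trichotomy q (x n₀) with h | h | h
  · exact (hf q ⟨hq.1, EReal.coe_lt_coe_iff.2 h⟩).congr (hl q h)
  · refine ⟨fun hqx => (hqx ⟨n₀, h.symm⟩).elim, fun n hn => ?_⟩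
    obtain rfl := hR.injective (hn.trans h)
    subst h
    refine jumpCondition_iff.2 ⟨y.1, y.2, h₁.congr' ?_, h₂.congr' ?_, h₃.congr' ?_, h₄.congr' ?_⟩
    · filter_upwards [self_mem_nhdsWithin] with t ht using (hl t ht).eq_of_nhds
    · filter_upwards [self_mem_nhdsWithin] with t ht using (hl t ht).deriv_eq
    · filter_upwards [self_mem_nhdsWithin] with t ht using (hr t ht).eq_of_nhds
    · filter_upwards [self_mem_nhdsWithin] with t ht using (hr t ht).deriv_eq
  · exact (hg q ⟨EReal.coe_lt_coe_iff.2 h, hq.2⟩).congr (hr q h)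

theorem memLp_piecewise {f g : ℝ → ℂ} (hf : MemLp f 2 (volume.restrict (interval a p)))
    (hg : MemLp g 2 (volume.restrict (interval p b))) :
    MemLp ((Iio p).piecewise f g) 2 (volume.restrict (interval a b)) := by
  refine MemLp.piecewise measurableSet_Iio ?_ ?_
  · rw [Measure.restrict_restrict measurableSet_Iio]
    have hsub : Iio p ∩ interval a b ⊆ interval a p := fun t ht =>
      ⟨ht.2.1, EReal.coe_lt_coe_iff.2 ht.1⟩
    exact hf.mono_measure (Measure.restrict_mono_set _ hsub)
  -- The complement of `Iio p` contains `p`, the interval to the right does not; a single point is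
  -- null.
  · rw [Measure.restrict_restrict measurableSet_Iio.compl, compl_Iio,
      Measure.restrict_congr_set (Ioi_ae_eq_Ici.symm.inter (ae_eq_refl (interval a b)))]
    have hsub : Ioi p ∩ interval a b ⊆ interval p b := fun t ht =>
      ⟨EReal.coe_lt_coe_iff.2 ht.1, ht.2.2⟩
    exact hg.mono_measure (Measure.restrict_mono_set _ hsub)

theorem wronskian_eventuallyEq {l : Filter ℝ} {f g v : ℝ → ℂ} {S : Set ℝ} (hJ : IsOpen J)
    (hJl : J ∈ l) (hfg : EqOn f g J) : wronskian v f =ᶠ[l ⊓ 𝓟 S] wronskian v g := by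
  filter_upwards [mem_inf_of_left hJl] with t ht
  have h := hfg.eventuallyEq_of_mem (hJ.mem_nhds ht)
  rw [wronskian, wronskian, h.eq_of_nhds, h.deriv_eq]

/-- By continuity off the interaction points, vanishing almost everywhere would be vanishing at all
regular points, and both limits along `m` would be zero. -/
theorem not_ae_eq_zero (hR : Regular J Q x κ) (hf : SolOn J Q x κ z f) {m : Filter ℝ} [m.NeBot]
    (hm : J \ range x ∈ m) {y : ℂ × ℂ} (h₀ : Tendsto f m (𝓝 y.1))
    (h₁ : Tendsto (deriv f) m (𝓝 y.2)) (hy : y ≠ 0) :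
    ¬ ∀ᵐ t ∂(volume.restrict J), f t = 0 := by
  intro hae
  have hE : EqOn f 0 (J \ range x) := by
    refine Measure.eqOn_open_of_ae_eq (μ := volume) ?_ hR.isOpen_diff hf.continuousOn
      continuousOn_const
    rw [Measure.restrict_congr_set (diff_range_ae_eq x J)]
    exact hae
  refine hy (Prod.ext ?_ ?_)
  · refine tendsto_nhds_unique h₀ (tendsto_const_nhds.congr' ?_)
    filter_upwards [hm] with t ht using (hE ht).symm
  · refine tendsto_nhds_unique h₁ (tendsto_const_nhds.congr' ?_)
    filter_upwards [hm] with t ht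
    rw [(hE.eventuallyEq_of_mem (hR.isOpen_diff.mem_nhds ht)).deriv_eq]
    simp

theorem diff_mem_nhdsLT (hR : Regular (interval a b) Q x κ) (hp : p ∈ interval a b) :
    interval a p \ range x ∈ 𝓝[<] p := by
  filter_upwards [self_mem_nhdsWithin, (hR.eventually_diff hp).filter_mono
    (nhdsWithin_mono p fun t (ht : t < p) => ht.ne)] with t h₁ h₂
  exact ⟨⟨h₂.1.1, EReal.coe_lt_coe_iff.2 h₁⟩, h₂.2⟩

theorem diff_mem_nhdsGT (hR : Regular (interval a b) Q x κ) (hp : p ∈ interval a b) :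
    interval p b \ range x ∈ 𝓝[>] p := by
  filter_upwards [self_mem_nhdsWithin, (hR.eventually_diff hp).filter_mono
    (nhdsWithin_mono p fun t (ht : p < t) => ht.ne')] with t h₁ h₂
  exact ⟨⟨EReal.coe_lt_coe_iff.2 h₁, h₂.1.2⟩, h₂.2⟩

/-- The boundary values at `p` coming from the left end point. -/
def leftValues (a b : EReal) (V : ℝ → ℝ) (x : I → ℝ) (κ : Couplings I) (v : ℝ → ℝ) (p : ℝ)
    (E : ℝ) : Set (ℂ × ℂ) :=
  boundaryValues (interval a p) (leftEnd a) (𝓝[<] p) (primitive V p) x κ E v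
    (LimitCircleLeft a b V x κ)

/-- The boundary values at `p` coming from the right end point. -/
def rightValues (a b : EReal) (V : ℝ → ℝ) (x : I → ℝ) (κ : Couplings I) (w : ℝ → ℝ) (p : ℝ)
    (E : ℝ) : Set (ℂ × ℂ) :=
  boundaryValues (interval p b) (rightEnd b) (𝓝[>] p) (primitive V p) x κ E w
    (LimitCircleRight a b V x κ)

/-- `E` is an eigenvalue if and only if the interaction matrix at `n₀` maps a non-zero boundary
value from the left to a boundary value from the right. -/
theorem mem_pointSpectrum_iff (hV : LocallyIntegrableOn V (interval a b))
    (hx_mem : ∀ n, x n ∈ interval a b) (hx_inj : Function.Injective x)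
    (hx_acc : ∀ p ∈ interval a b, ¬ AccPt p (𝓟 (range x))) (hr : ∀ n, 0 < κ.r n)
    {lam : ℝ} {v w : ℝ → ℝ} (hv : IsRealSolutionNearLeft a b V x κ lam v)
    (hw : IsRealSolutionNearRight a b V x κ lam w) (n₀ : I) (E : ℝ) {α r θ : ℝ} (hr₀ : 0 < r) :
    (E : ℂ) ∈ pointSpectrum a b V x v w (κ.replaceAt n₀ α r θ) ↔
      ∃ y ∈ leftValues a b V x κ v (x n₀) E, y ≠ 0 ∧
        mulPair (interactionMatrix α r θ) y ∈ rightValues a b V x κ w (x n₀) E := by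
  set p := x n₀ with hp_def
  have hp : p ∈ interval a b := hx_mem n₀
  have hab : a < b := hp.1.trans hp.2
  set κ' := κ.replaceAt n₀ α r θ
  have hR : Regular (interval a b) (primitive V p) x κ :=
    regular_interval hV hx_inj hx_acc hr hp
  have hR' : Regular (interval a b) (primitive V p) x κ' :=
    regular_interval hV hx_inj hx_acc (r_replaceAt_pos hr hr₀) hp
  have hκ : ∀ n, x n ≠ p → κ'.matrix n = κ.matrix n := fun n hn =>
    matrix_replaceAt_of_ne (fun h => hn (congrArg x h)) α r θ
  have hκ₀ : κ'.matrix n₀ = interactionMatrix α r θ := matrix_replaceAt_self n₀ α r θ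
  have hκl : ∀ n, x n ∈ interval a p → κ'.matrix n = κ.matrix n := fun n hn =>
    hκ n fun h => hn.2.ne (by rw [h])
  have hκr : ∀ n, x n ∈ interval p b → κ'.matrix n = κ.matrix n := fun n hn =>
    hκ n fun h => hn.1.ne (by rw [h])
  have hLl : LimitCircleLeft a b V x κ ↔ LimitCircleLeft a b V x κ' :=
    ⟨fun h => h.congr hV hp hR hR' hκ, fun h => h.congr hV hp hR' hR fun n hn => (hκ n hn).symm⟩
  have hLr : LimitCircleRight a b V x κ ↔ LimitCircleRight a b V x κ' :=
    ⟨fun h => h.congr hV hp hR hR' hκ, fun h => h.congr hV hp hR' hR fun n hn => (hκ n hn).symm⟩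
  have hsl : interval a p ⊆ interval a b := interval_subset_interval le_rfl hp.2.le
  have hsr : interval p b ⊆ interval a b := interval_subset_interval hp.1.le le_rfl
  obtain ⟨Nv, hNv, hNvs, hRv, hv₁, -⟩ := hv.exists_nhds hV hp hR
  obtain ⟨Nw, hNw, hNws, hRw, hw₁, -⟩ := hw.exists_nhds hV hp hR
  have bl : ∀ {f}, SolOn (interval a p) (primitive V p) x κ E f →
      (Tendsto (lagrangeBracket (fun t => (v t : ℂ)) f) (leftEnd a) (𝓝 0) ↔
        Tendsto (wronskian (fun t => (v t : ℂ)) f) (leftEnd a ⊓ 𝓟 (range x)ᶜ) (𝓝 0)) := fun hf =>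
    tendsto_lagrangeBracket_iff (isEnd_leftEnd hab) hRv hNv hv₁ (hf.mono hNvs)
  have br : ∀ {f}, SolOn (interval p b) (primitive V p) x κ E f →
      (Tendsto (lagrangeBracket (fun t => (w t : ℂ)) f) (rightEnd b) (𝓝 0) ↔
        Tendsto (wronskian (fun t => (w t : ℂ)) f) (rightEnd b ⊓ 𝓟 (range x)ᶜ) (𝓝 0)) := fun hf =>
    tendsto_lagrangeBracket_iff (isEnd_rightEnd hab) hRw hNw hw₁ (hf.mono hNws)
  constructor
  · rintro ⟨f, ⟨⟨hfL, hfc, -⟩, hfa, hfb⟩, hf0, hfE⟩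
    have hsol : SolOn (interval a b) (primitive V p) x κ' E f := by
      rw [← isSolution_iff_solOn hV hp Subset.rfl hR']
      exact ⟨hfc, hfE.mono fun t ht => by rw [ht, sub_self]⟩
    have hsoll := (hsol.mono hsl).congr_couplings hκl
    have hsolr := (hsol.mono hsr).congr_couplings hκr
    obtain ⟨l₀, l₁, h₁, h₂, h₃, h₄⟩ := jumpCondition_iff.1 ((hsol p hp).2 n₀ rfl)
    rw [hκ₀] at h₃ h₄
    refine ⟨(l₀, l₁), ⟨f, hsoll, hfL.mono_measure (Measure.restrict_mono_set _ hsl),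
      fun hP => (bl hsoll).1 (hfa (hLl.1 hP)), h₁, h₂⟩, fun h => hf0 ?_,
      ⟨f, hsolr, hfL.mono_measure (Measure.restrict_mono_set _ hsr),
      fun hP => (br hsolr).1 (hfb (hLr.1 hP)), h₃, h₄⟩⟩
    -- Zero boundary values at `p-` would make the eigenfunction vanish on both sides.
    obtain ⟨rfl, rfl⟩ := Prod.mk_eq_zero.1 h
    have hE := hsol.eqOn_zero_of_tendsto_zero hR' hp h₁ h₂
    filter_upwards [ae_restrict_mem hR.isOpen.measurableSet,
      ae_notMem_range x _ Measure.restrict_le_self.absolutelyContinuous] with t ht htx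
    exact hE ⟨ht, htx⟩
  · rintro ⟨y, ⟨f, f₁, f₂, f₃, f₄, f₅⟩, hy, ⟨g, g₁, g₂, g₃, g₄, g₅⟩⟩
    rw [← hκ₀] at g₄ g₅
    set F := (Iio p).piecewise f g
    have hF : SolOn (interval a b) (primitive V p) x κ' E F :=
      SolOn.glue hR' hp (f₁.congr_couplings fun n hn => (hκl n hn).symm)
        (g₁.congr_couplings fun n hn => (hκr n hn).symm) f₄ f₅ g₄ g₅
    have hFl : EqOn f F (interval a p) := fun t ht =>
      (piecewise_eq_of_mem (Iio p) f g (EReal.coe_lt_coe_iff.1 ht.2)).symm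
    have hFr : EqOn g F (interval p b) := fun t ht =>
      (piecewise_eq_of_notMem (Iio p) f g
        (notMem_Iio.2 (EReal.coe_lt_coe_iff.1 ht.1).le)).symm
    have hFs := (isSolution_iff_solOn hV hp Subset.rfl hR').2 hF
    have hFE : ∀ᵐ t ∂(volume.restrict (interval a b)), tau V F t = E * F t :=
      hFs.2.mono fun t ht => sub_eq_zero.1 ht
    have hFL : MemLp F 2 (volume.restrict (interval a b)) := memLp_piecewise f₂ g₂
    refine ⟨F, ⟨⟨hFL, hFs.1, (hFL.const_mul (E : ℂ)).ae_eq (hFE.mono fun t ht => ht.symm)⟩,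
      fun hP => ?_, fun hP => ?_⟩, fun h => ?_, hFE⟩
    · refine (bl (f₁.congr (isOpen_interval a p) hFl)).2 ((f₃ (hLl.2 hP)).congr' ?_)
      exact wronskian_eventuallyEq (isOpen_interval a p) (interval_left_mem hp) hFl
    · refine (br (g₁.congr (isOpen_interval p b) hFr)).2 ((g₃ (hLr.2 hP)).congr' ?_)
      exact wronskian_eventuallyEq (isOpen_interval p b) (interval_right_mem hp) hFr
    · refine not_ae_eq_zero (hR.mono (isOpen_interval a p) (ordConnected_interval a p) hsl) f₁
        (diff_mem_nhdsLT hR hp) f₄ f₅ hy ?_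
      filter_upwards [ae_mono (Measure.restrict_mono_set _ hsl) h,
        ae_restrict_mem (isOpen_interval a p).measurableSet] with t h₁ h₂
      rw [hFl h₂, h₁]

/-! ### Intersections of the parameter set with coordinate lines -/

theorem interactionMatrix_eq (α r θ : ℝ) : interactionMatrix α r θ =
    !![r * Real.cos θ + α * (1 / r) * Real.sin θ, -(r * Real.sin θ) + α * (1 / r) * Real.cos θ;
      1 / r * Real.sin θ, 1 / r * Real.cos θ] := by
  simp [interactionMatrix, parabolic, hyperbolic, elliptic]

/-- If the admissible boundary values form real subspaces of dimension at most one, the parameter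
set is empty or the zero set of a function. -/
theorem exists_matrix_condition {S T : Set (ℂ × ℂ)}
    (hT : ∀ y ∈ T, ∀ c : ℂ, c • y ∈ T) (hSd : ∀ y ∈ S, ∀ y' ∈ S, y.1 * y'.2 - y.2 * y'.1 = 0)
    (hTd : ∀ y ∈ T, ∀ y' ∈ T, y.1 * y'.2 - y.2 * y'.1 = 0)
    (hSc : ∀ y ∈ S, (starRingEnd ℂ y.1, starRingEnd ℂ y.2) ∈ S) :
    (∀ α r θ : ℝ, 0 < r → ¬ ∃ y ∈ S, y ≠ 0 ∧ mulPair (interactionMatrix α r θ) y ∈ T) ∨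
    ∃ l m : ℂ × ℂ, l.1 ^ 2 + l.2 ^ 2 ≠ 0 ∧ m ≠ 0 ∧ ∀ α r θ : ℝ, 0 < r →
      ((∃ y ∈ S, y ≠ 0 ∧ mulPair (interactionMatrix α r θ) y ∈ T) ↔
        (r : ℂ) ^ 2 * ((Real.cos θ * l.1 - Real.sin θ * l.2) * m.2) +
          (Real.sin θ * l.1 + Real.cos θ * l.2) * (α * m.2 - m.1) = 0) := by
  have hprop : ∀ y y' : ℂ × ℂ, y ≠ 0 → y.1 * y'.2 - y.2 * y'.1 = 0 → ∃ c : ℂ, y' = c • y := by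
    intro y y' hy h
    by_cases h₁ : y.1 = 0
    · have h₂ : y.2 ≠ 0 := fun h₂ => hy (Prod.ext h₁ h₂)
      refine ⟨y'.2 / y.2, Prod.ext ?_ ?_⟩
      · rw [h₁, zero_mul, zero_sub, neg_eq_zero, mul_eq_zero] at h
        simp [h₁, h.resolve_left h₂]
      · simp [h₂]
    · refine ⟨y'.1 / y.1, Prod.ext ?_ ?_⟩
      · simp [h₁]
      · rw [Prod.smul_snd, smul_eq_mul]
        field_simp
        linear_combination h
  have hmul : ∀ (A : Matrix (Fin 2) (Fin 2) ℝ) (c : ℂ) (y : ℂ × ℂ),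
      mulPair A (c • y) = c • mulPair A y := fun A c y => by
    ext1 <;> simp only [mulPair, Prod.smul_fst, Prod.smul_snd, smul_eq_mul] <;> ring
  by_cases hex : ∃ α r θ : ℝ, 0 < r ∧ ∃ y ∈ S, y ≠ 0 ∧ mulPair (interactionMatrix α r θ) y ∈ T
  · right
    obtain ⟨α₀, r₀, θ₀, hr₀, l, hl, hl0, hm⟩ := hex
    set m := mulPair (interactionMatrix α₀ r₀ θ₀) l with hm_def
    -- An interaction matrix with `r₀ > 0` is injective: undo the parabolic and hyperbolic factors,
    -- then the rotation.
    have hm0 : m ≠ 0 := by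
      intro h
      have hr' : (r₀ : ℂ) ≠ 0 := by exact_mod_cast hr₀.ne'
      have hcs : (Real.cos θ₀ : ℂ) ^ 2 + (Real.sin θ₀ : ℂ) ^ 2 = 1 := by
        exact_mod_cast Real.cos_sq_add_sin_sq θ₀
      rw [hm_def, interactionMatrix_eq] at h
      obtain ⟨e₁, e₂⟩ := Prod.mk_eq_zero.1 h
      simp only [Matrix.of_apply, Matrix.cons_val', Matrix.cons_val_zero, Matrix.cons_val_one,
        Matrix.cons_val_fin_one, Complex.ofReal_add, Complex.ofReal_mul, Complex.ofReal_div,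
        Complex.ofReal_one, Complex.ofReal_neg] at e₁ e₂
      have e₃ : (Real.sin θ₀ : ℂ) * l.1 + Real.cos θ₀ * l.2 = 0 := by
        have : (r₀ : ℂ) * (1 / r₀ * Real.sin θ₀ * l.1 + 1 / r₀ * Real.cos θ₀ * l.2) = 0 := by
          rw [e₂, mul_zero]
        field_simp at this
        linear_combination this
      have e₄ : (Real.cos θ₀ : ℂ) * l.1 - Real.sin θ₀ * l.2 = 0 := by
        refine (mul_eq_zero.1 (?_ : (r₀ : ℂ) * _ = 0)).resolve_left hr'
        linear_combination e₁ - α₀ * (1 / r₀) * e₃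
      refine hl0 (Prod.ext ?_ ?_)
      · change l.1 = 0
        linear_combination Real.sin θ₀ * e₃ + Real.cos θ₀ * e₄ - l.1 * hcs
      · change l.2 = 0
        linear_combination Real.cos θ₀ * e₃ - Real.sin θ₀ * e₄ - l.2 * hcs
    refine ⟨l, m, ?_, hm0, fun α r θ hr => ?_⟩
    -- `l₁² + l₂² = 0` means `l₁ = ± i l₂`. Proportionality of `l` to its conjugate then forces
    -- `|l₂|² = 0`, so `l = 0`.
    · intro h
      have hc := hSd l hl _ (hSc l hl)
      have hfac : (l.1 - Complex.I * l.2) * (l.1 + Complex.I * l.2) = 0 := by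
        linear_combination h - l.2 ^ 2 * Complex.I_sq
      have hl2 : l.2 * starRingEnd ℂ l.2 = 0 := by
        rcases mul_eq_zero.1 hfac with h' | h'
        · have h₁ : l.1 = Complex.I * l.2 := by linear_combination h'
          simp only [h₁, map_mul, Complex.conj_I] at hc
          have : (2 * Complex.I) * (l.2 * starRingEnd ℂ l.2) = 0 := by linear_combination hc
          exact (mul_eq_zero.1 this).resolve_left (by simp)
        · have h₁ : l.1 = -(Complex.I * l.2) := by linear_combination h'
          simp only [h₁, map_mul, map_neg, Complex.conj_I] at hc
          have : (2 * Complex.I) * (l.2 * starRingEnd ℂ l.2) = 0 := by linear_combination -hc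
          exact (mul_eq_zero.1 this).resolve_left (by simp)
      have h2 : l.2 = 0 := by
        rcases mul_eq_zero.1 hl2 with h' | h'
        · exact h'
        · simpa using h'
      have h1 : l.1 = 0 := by
        rw [h2] at h
        simpa using h
      exact hl0 (Prod.ext h1 h2)
    · have hr' : (r : ℂ) ≠ 0 := by exact_mod_cast hr.ne'
      have h₁ : (∃ y ∈ S, y ≠ 0 ∧ mulPair (interactionMatrix α r θ) y ∈ T) ↔
          (mulPair (interactionMatrix α r θ) l).1 * m.2 -
            (mulPair (interactionMatrix α r θ) l).2 * m.1 = 0 := by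
        constructor
        · rintro ⟨y, hy, hy0, hyT⟩
          obtain ⟨c, rfl⟩ := hprop y l hy0 (hSd y hy l hl)
          have := hTd _ hyT m hm
          rw [hmul]
          simp only [Prod.smul_fst, Prod.smul_snd, smul_eq_mul]
          linear_combination c * this
        · intro h
          obtain ⟨c, hc⟩ := hprop m (mulPair (interactionMatrix α r θ) l) hm0
            (by linear_combination -h)
          exact ⟨l, hl, hl0, hc ▸ hT m hm c⟩
      rw [h₁, interactionMatrix_eq]
      simp only [mulPair, Matrix.of_apply, Matrix.cons_val', Matrix.cons_val_zero,
        Matrix.cons_val_one, Matrix.cons_val_fin_one, Complex.ofReal_add, Complex.ofReal_mul,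
        Complex.ofReal_div, Complex.ofReal_one, Complex.ofReal_neg]
      -- Multiplying the determinant by `r` clears the entries `1 / r`.
      rw [← mul_eq_zero_iff_left hr']
      refine Eq.congr ?_ rfl
      field_simp
      ring
  · left
    push Not at hex
    rintro α r θ hr ⟨y, h₁, h₂, h₃⟩
    exact hex α r θ hr y h₁ h₂ h₃

/-- The zeros of a non-trivial combination of cosine and sine. -/
theorem countable_infinite_zeros {X Y : ℂ} (hXY : ¬ (X = 0 ∧ Y = 0)) :
    {θ : ℝ | Real.cos θ * X + Real.sin θ * Y = 0} = ∅ ∨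
      ({θ : ℝ | Real.cos θ * X + Real.sin θ * Y = 0}.Countable ∧
        {θ : ℝ | Real.cos θ * X + Real.sin θ * Y = 0}.Infinite) := by
  rcases eq_empty_or_nonempty {θ : ℝ | Real.cos θ * X + Real.sin θ * Y = 0} with h | ⟨θ₀, h₀⟩
  · exact Or.inl h
  right
  have h₀' : Real.cos θ₀ * X + Real.sin θ₀ * Y = 0 := h₀
  have hrange : {θ : ℝ | Real.cos θ * X + Real.sin θ * Y = 0} =
      range fun n : ℤ => θ₀ + n * Real.pi := by
    ext θ
    constructor
    · intro h
      have h' : Real.cos θ * X + Real.sin θ * Y = 0 := h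
      -- Up to sign, `sin (θ - θ₀)` is the determinant of the two equations at `θ` and `θ₀` for the
      -- non-zero vector `(X, Y)`.
      have hs : (Real.sin (θ - θ₀) : ℂ) = 0 := by
        rw [Real.sin_sub]
        push_cast
        by_contra hne
        refine hXY ⟨?_, ?_⟩
        · refine (mul_eq_zero.1 (?_ : _ * X = 0)).resolve_left hne
          push_cast at h' h₀'
          linear_combination Complex.sin θ * h₀' - Complex.sin θ₀ * h'
        · refine (mul_eq_zero.1 (?_ : _ * Y = 0)).resolve_left hne
          push_cast at h' h₀'
          linear_combination Complex.cos θ₀ * h' - Complex.cos θ * h₀'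
      obtain ⟨n, hn⟩ := Real.sin_eq_zero_iff.1 (Complex.ofReal_eq_zero.1 hs)
      exact ⟨n, by simp only; linarith⟩
    · rintro ⟨n, rfl⟩
      change ((Real.cos (θ₀ + n * Real.pi) : ℝ) : ℂ) * X + (Real.sin (θ₀ + n * Real.pi) : ℝ) * Y = 0
      rw [Real.cos_add_int_mul_pi, Real.sin_add_int_mul_pi]
      push_cast at h₀' ⊢
      linear_combination (-1 : ℂ) ^ n * h₀'
  rw [hrange]
  refine ⟨countable_range _, infinite_range_of_injective fun i j hij => ?_⟩
  simpa [Real.pi_ne_zero] using hij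

end PointInteraction

end

/-! ### The three coordinate lines. -/

theorem mainTheorem3
    (a b : EReal) (hab : a < b)
    (V : ℝ → ℝ) (hV : MeasureTheory.LocallyIntegrableOn V (PointInteraction.interval a b))
    (I : Set ℤ) (x : I → ℝ) (hx_mem : ∀ n, x n ∈ PointInteraction.interval a b)
    (hx_inj : Function.Injective x)
    (hx_acc : ∀ p ∈ PointInteraction.interval a b, ¬ AccPt p (Filter.principal (Set.range x)))
    (κ : PointInteraction.Couplings I) (hr : ∀ n, 0 < κ.r n)
    (lam : ℝ) (v w : ℝ → ℝ)
    (hv : PointInteraction.IsRealSolutionNearLeft a b V x κ lam v)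
    (hw : PointInteraction.IsRealSolutionNearRight a b V x κ lam w)
    (n₀ : I) (E : ℝ) :
    (∀ α₀ r₀ : ℝ, 0 < r₀ →
      {p ∈ PointInteraction.parameterSet a b V x v w κ n₀ E | p.1 = α₀ ∧ p.2.1 = r₀} = ∅ ∨
      ({p ∈ PointInteraction.parameterSet a b V x v w κ n₀ E |
          p.1 = α₀ ∧ p.2.1 = r₀}.Countable ∧
        {p ∈ PointInteraction.parameterSet a b V x v w κ n₀ E |
          p.1 = α₀ ∧ p.2.1 = r₀}.Infinite)) ∧
    (∀ α₀ θ₀ : ℝ,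
      {p ∈ PointInteraction.parameterSet a b V x v w κ n₀ E |
          p.1 = α₀ ∧ p.2.2 = θ₀}.Subsingleton ∨
      {p ∈ PointInteraction.parameterSet a b V x v w κ n₀ E | p.1 = α₀ ∧ p.2.2 = θ₀} =
        {α₀} ×ˢ Set.Ioi (0 : ℝ) ×ˢ {θ₀}) ∧
    (∀ r₀ θ₀ : ℝ, 0 < r₀ →
      {p ∈ PointInteraction.parameterSet a b V x v w κ n₀ E |
          p.2.1 = r₀ ∧ p.2.2 = θ₀}.Subsingleton ∨
      {p ∈ PointInteraction.parameterSet a b V x v w κ n₀ E | p.2.1 = r₀ ∧ p.2.2 = θ₀} =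
        Set.univ ×ˢ {r₀} ×ˢ {θ₀}) := by
  open PointInteraction in
  have hp := hx_mem n₀
  have hR := regular_interval hV hx_inj hx_acc hr hp
  have hsl : interval a (x n₀) ⊆ interval a b := interval_subset_interval le_rfl hp.2.le
  have hsr : interval (x n₀) b ⊆ interval a b := interval_subset_interval hp.1.le le_rfl
  have hRl := hR.mono (isOpen_interval a (x n₀)) (ordConnected_interval _ _) hsl
  have hRr := hR.mono (isOpen_interval (x n₀) b) (ordConnected_interval _ _) hsr
  obtain ⟨Nv, hNv, hNvs, -, hv₁, hv₂⟩ := hv.exists_nhds hV hp hR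
  obtain ⟨Nw, hNw, hNws, -, hw₁, hw₂⟩ := hw.exists_nhds hV hp hR
  have hmem : ∀ α r θ : ℝ, (α, r, θ) ∈ parameterSet a b V x v w κ n₀ E ↔ 0 < r ∧
      ∃ y ∈ leftValues a b V x κ v (x n₀) E, y ≠ 0 ∧
        mulPair (interactionMatrix α r θ) y ∈ rightValues a b V x κ w (x n₀) E := fun α r θ =>
    and_congr_right fun h => mem_pointSpectrum_iff hV hx_mem hx_inj hx_acc hr hv hw n₀ E h
  have hdichotomy := exists_matrix_condition
    (S := leftValues a b V x κ v (x n₀) E) (T := rightValues a b V x κ w (x n₀) E)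
    (fun y hy c => boundaryValues_smul hRr (interval_right_mem hp) (diff_mem_nhdsGT hR hp) hy c)
    (fun y hy y' hy' => boundaryValues_det_eq_zero (isEnd_leftEnd hab) hRl (interval_left_mem hp)
      (diff_mem_nhdsLT hR hp) (fun h => by
        rw [limitCircleLeft_iff hab hV hp hR] at h
        push Not at h
        obtain ⟨z, f, h₁, h₂⟩ := h
        exact ⟨z, f, h₁.mono hsl, h₂⟩) hNv hNvs hv₁ hv₂ hy hy')
    (fun y hy y' hy' => boundaryValues_det_eq_zero (isEnd_rightEnd hab) hRr (interval_right_mem hp)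
      (diff_mem_nhdsGT hR hp) (fun h => by
        rw [limitCircleRight_iff hab hV hp hR] at h
        push Not at h
        obtain ⟨z, f, h₁, h₂⟩ := h
        exact ⟨z, f, h₁.mono hsr, h₂⟩) hNw hNws hw₁ hw₂ hy hy')
    (fun y hy => boundaryValues_conj hy)
  rcases hdichotomy with hempty | ⟨l, m, hl, hm, hcond⟩
  · have hP : parameterSet a b V x v w κ n₀ E = ∅ := by
      rw [Set.eq_empty_iff_forall_notMem]
      rintro ⟨α, r, θ⟩ h
      exact hempty α r θ ((hmem α r θ).1 h).1 ((hmem α r θ).1 h).2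
    simp [hP]
  have hmem' : ∀ α r θ : ℝ, (α, r, θ) ∈ parameterSet a b V x v w κ n₀ E ↔ 0 < r ∧
      (r : ℂ) ^ 2 * ((Real.cos θ * l.1 - Real.sin θ * l.2) * m.2) +
          (Real.sin θ * l.1 + Real.cos θ * l.2) * (α * m.2 - m.1) = 0 := fun α r θ =>
    (hmem α r θ).trans (and_congr_right fun h => hcond α r θ h)
  refine ⟨fun α₀ r₀ hr₀ => ?_, fun α₀ θ₀ => ?_, fun r₀ θ₀ hr₀ => ?_⟩
  · have hr₀' : (r₀ : ℂ) ≠ 0 := by exact_mod_cast hr₀.ne'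
    -- `X` and `Y` are the coefficients of `cos θ` and `sin θ`.
    set X : ℂ := (r₀ : ℂ) ^ 2 * (l.1 * m.2) + l.2 * (α₀ * m.2 - m.1)
    set Y : ℂ := -((r₀ : ℂ) ^ 2 * (l.2 * m.2)) + l.1 * (α₀ * m.2 - m.1)
    have hXY : ¬ (X = 0 ∧ Y = 0) := by
      rintro ⟨hX, hY⟩
      -- `(X, Y)` arises from `(r₀² m₂, α₀ m₂ - m₁)` by a matrix of determinant `l₁² + l₂²`;
      -- multiplying by its adjugate shows `m = 0`.
      have h₁ : (l.1 ^ 2 + l.2 ^ 2) * ((r₀ : ℂ) ^ 2 * m.2) = 0 := by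
        simp only [X, Y] at hX hY
        linear_combination l.1 * hX - l.2 * hY
      have h₂ : (l.1 ^ 2 + l.2 ^ 2) * (α₀ * m.2 - m.1) = 0 := by
        simp only [X, Y] at hX hY
        linear_combination l.2 * hX + l.1 * hY
      have h₃ : m.2 = 0 := by
        simpa [hr₀'] using (mul_eq_zero.1 h₁).resolve_left hl
      have h₄ := (mul_eq_zero.1 h₂).resolve_left hl
      rw [h₃, mul_zero, zero_sub, neg_eq_zero] at h₄
      exact hm (Prod.ext h₄ h₃)
    have himage : {p ∈ parameterSet a b V x v w κ n₀ E | p.1 = α₀ ∧ p.2.1 = r₀} =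
        (fun θ : ℝ => (α₀, r₀, θ)) '' {θ : ℝ | Real.cos θ * X + Real.sin θ * Y = 0} := by
      ext ⟨α, r, θ⟩
      constructor
      · rintro ⟨h, rfl, rfl⟩
        refine ⟨θ, ?_, rfl⟩
        have := ((hmem' _ _ _).1 h).2
        change (Real.cos θ : ℂ) * X + Real.sin θ * Y = 0
        simp only [X, Y]
        linear_combination this
      · rintro ⟨θ, h, heq⟩
        obtain ⟨rfl, rfl, rfl⟩ : α₀ = α ∧ r₀ = r ∧ θ = _ := by simpa using heq
        have h' : (Real.cos θ : ℂ) * X + Real.sin θ * Y = 0 := h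
        refine ⟨(hmem' _ _ _).2 ⟨hr₀, ?_⟩, rfl, rfl⟩
        simp only [X, Y] at h'
        linear_combination h'
    have hinj : Function.Injective (fun θ : ℝ => (α₀, r₀, θ)) := fun θ θ' h => by simpa using h
    rw [himage]
    rcases countable_infinite_zeros hXY with h | ⟨h₁, h₂⟩
    · left
      rw [h, Set.image_empty]
    · exact Or.inr ⟨h₁.image _, h₂.image hinj.injOn⟩
  -- The condition reads `r² X + Y = 0`, and `r² ` determines `r` because `r > 0`.
  · set X : ℂ := (Real.cos θ₀ * l.1 - Real.sin θ₀ * l.2) * m.2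
    set Y : ℂ := (Real.sin θ₀ * l.1 + Real.cos θ₀ * l.2) * (α₀ * m.2 - m.1)
    by_cases hX : X = 0
    · by_cases hY : Y = 0
      · right
        ext ⟨α, r, θ⟩
        constructor
        · rintro ⟨h, rfl, rfl⟩
          exact ⟨rfl, ((hmem' _ _ _).1 h).1, rfl⟩
        · rintro ⟨h₁, h₂, h₃⟩
          obtain rfl : α = α₀ := h₁
          obtain rfl : θ = θ₀ := h₃
          refine ⟨(hmem' _ _ _).2 ⟨h₂, ?_⟩, rfl, rfl⟩
          linear_combination (r : ℂ) ^ 2 * hX + hY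
      · left
        rintro ⟨α, r, θ⟩ ⟨h, rfl, rfl⟩
        refine (hY ?_).elim
        linear_combination ((hmem' _ _ _).1 h).2 - (r : ℂ) ^ 2 * hX
    · left
      rintro ⟨α, r, θ⟩ ⟨h, rfl, rfl⟩ ⟨α', r', θ'⟩ ⟨h', hα, hθ⟩
      simp only at hα hθ
      subst hα hθ
      obtain ⟨k₁, k₂⟩ := (hmem' _ _ _).1 h
      obtain ⟨k₁', k₂'⟩ := (hmem' _ _ _).1 h'
      have hsq : (r : ℂ) ^ 2 = (r' : ℂ) ^ 2 := by
        apply mul_right_cancel₀ hX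
        linear_combination k₂ - k₂'
      have hsq' : r ^ 2 = r' ^ 2 := by exact_mod_cast hsq
      rw [(sq_eq_sq₀ k₁.le k₁'.le).1 hsq']
  -- The condition reads `α X + Y = 0`.
  · set X : ℂ := (Real.sin θ₀ * l.1 + Real.cos θ₀ * l.2) * m.2
    set Y : ℂ := (r₀ : ℂ) ^ 2 * ((Real.cos θ₀ * l.1 - Real.sin θ₀ * l.2) * m.2) -
      (Real.sin θ₀ * l.1 + Real.cos θ₀ * l.2) * m.1
    by_cases hX : X = 0
    · by_cases hY : Y = 0
      · right
        ext ⟨α, r, θ⟩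
        constructor
        · rintro ⟨h, rfl, rfl⟩
          exact ⟨trivial, rfl, rfl⟩
        · rintro ⟨-, h₂, h₃⟩
          obtain rfl : r = r₀ := h₂
          obtain rfl : θ = θ₀ := h₃
          refine ⟨(hmem' _ _ _).2 ⟨hr₀, ?_⟩, rfl, rfl⟩
          linear_combination (α : ℂ) * hX + hY
      · left
        rintro ⟨α, r, θ⟩ ⟨h, rfl, rfl⟩
        refine (hY ?_).elim
        linear_combination ((hmem' _ _ _).1 h).2 - (α : ℂ) * hX
    · left
      rintro ⟨α, r, θ⟩ ⟨h, rfl, rfl⟩ ⟨α', r', θ'⟩ ⟨h', hr', hθ⟩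
      simp only at hr' hθ
      subst hr' hθ
      have hα : (α : ℂ) = α' := by
        apply mul_right_cancel₀ hX
        linear_combination ((hmem' _ _ _).1 h).2 - ((hmem' _ _ _).1 h').2
      rw [Complex.ofReal_injective hα]
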